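/- All graphs are finite and simple. The Lov\'asz theta function $\vartheta(G)$ of a graph $G$ is the minimal $\kappa\ge 2$ for which one can assign to each vertex $v$ a unit vector $\mathbf{x}_v$ (in some Euclidean space) such that $\langle \mathbf{x}_u,\mathbf{x}_v\rangle=-\frac{1}{\kappa-1}$ for all distinct non-adjacent vertices $u,v$ of $G$. For a graph $H$ and $m\in\mathbb{N}$, let $\mu(m,H)$ be the maximum of $\vartheta(\overline{G})$, where $\overline{G}$ is the complement of $G$, over all graphs $G$ with exactly $m$ edges (and any number of vertices) that contain no copy of $H$ as a (not necessarily induced) subgraph, with $\mu(m,H)=0$ if there is no such $G$. Let $\mathrm{ex}(n,H)$ be the maximum number of edges of an $n$-vertex graph with no copy of $H$ as a subgraph (and $0$ if there is no such graph), and let $C_r$ be the cycle of length $r$. For every $r\ge 3$ there is a constant $C=C(r)$ such that $\mu(m,C_r)\le C\,m^{1/(r+2)}$ for all integers $m\ge 1$. Moreover, if $H$ is a graph that has a vertex whose removal makes $H$ acyclic, and $\mathrm{ex}(n,H)=O(n^{1+\alpha})$ as $n\to\infty$ for some real constant $\alpha\ne -1$, then there is a constant $C=C(H,\alpha)$ such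 that $\mu(m,H)\le C\,m^{\alpha/(2\alpha+2)}$ for all integers $m\ge 1$. -/

import Mathlib

/-- `κ ≥ 2` is feasible for `G` if one can choose a unit vector for each vertex, in some Euclidean
space, so that `⟪x u, x v⟫ = -1 / (κ - 1)` for all distinct non-adjacent `u` and `v`. -/
def ThetaFeasible {V : Type*} (G : SimpleGraph V) (κ : ℝ) : Prop :=
  2 ≤ κ ∧ ∃ (d : ℕ) (x : V → EuclideanSpace ℝ (Fin d)), (∀ v, ‖x v‖ = 1) ∧
    ∀ u v, u ≠ v → ¬ G.Adj u v → inner ℝ (x u) (x v) = -1 / (κ - 1)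

/-- The Lovász theta function of a graph: the minimal feasible `κ ≥ 2`. -/
noncomputable def lovaszTheta {V : Type*} (G : SimpleGraph V) : ℝ :=
  sInf {κ : ℝ | ThetaFeasible G κ}

/-- The values of the Lovász theta function of the complement of `G`, over all finite graphs `G`
with exactly `m` edges that contain no (not necessarily induced) copy of `H`. Up to isomorphism the
vertex set is `Fin n`; the number `n` of vertices is not restricted. -/
def complThetaValues {W : Type*} (m : ℕ) (H : SimpleGraph W) : Set ℝ :=
  {t | ∃ (n : ℕ) (G : SimpleGraph (Fin n)),
    H.Free G ∧ G.edgeSet.ncard = m ∧ t = lovaszTheta Gᶜ}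

/-- `μ(m, H)`: the maximum of the Lovász theta function of the complement of `G` over all `H`-free
graphs `G` with `m` edges (and `0` if there is no such graph). -/
noncomputable def thetaMu {W : Type*} (m : ℕ) (H : SimpleGraph W) : ℝ :=
  sSup (complThetaValues m H)

/-- `H` has a vertex whose removal makes it acyclic. -/
def HasVertexWithAcyclicRemoval {W : Type*} (H : SimpleGraph W) : Prop :=
  ∃ v : W, (H.induce {v}ᶜ).IsAcyclic

/-- A proper colouring of `G` with `N ≥ 2` colours makes `N` feasible for the complement of `G`:
use the vertices of a regular simplex. -/
theorem thetaFeasible_compl_of_coloring {V : Type*} (G : SimpleGraph V) (N : ℕ) (hN : 2 ≤ N)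
    (f : V → Fin N) (hf : ∀ u v, G.Adj u v → f u ≠ f v) : ThetaFeasible Gᶜ (N : ℝ) := by
  have hN' : (2 : ℝ) ≤ N := by exact_mod_cast hN
  have hN0 : (N : ℝ) ≠ 0 := by positivity
  have hN1 : (N : ℝ) - 1 ≠ 0 := by linarith
  have key : ∀ i j : Fin N, ∑ k : Fin N, ((if k = i then (1 : ℝ) else 0) - 1 / N) *
      ((if k = j then (1 : ℝ) else 0) - 1 / N) = (if i = j then (1 : ℝ) else 0) - 1 / N := by
    intro i j
    simp only [sub_mul, mul_sub, Finset.sum_sub_distrib, ite_mul, mul_ite, one_mul, mul_one,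
      zero_mul, mul_zero, Finset.sum_ite_eq', Finset.mem_univ, if_true, Finset.sum_const,
      Finset.card_univ, Fintype.card_fin, nsmul_eq_mul]
    simp only [eq_comm (a := j) (b := i)]
    field_simp
    ring
  let y : Fin N → EuclideanSpace ℝ (Fin N) := fun i =>
    Real.sqrt (N / (N - 1)) • WithLp.toLp 2 (fun k => (if k = i then (1 : ℝ) else 0) - 1 / N)
  have hy : ∀ i j, inner ℝ (y i) (y j) =
      (N / (N - 1) : ℝ) * ((if i = j then (1 : ℝ) else 0) - 1 / N) := by
    intro i j
    have h0 : (0 : ℝ) ≤ N / (N - 1) := div_nonneg (by positivity) (by linarith)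
    simp only [y, inner_smul_left, inner_smul_right]
    rw [PiLp.inner_apply, ← key i j]
    simp only [RCLike.inner_apply, conj_trivial]
    rw [← mul_assoc, Real.mul_self_sqrt h0]
    congr 1
    exact Finset.sum_congr rfl fun _ _ => mul_comm _ _
  refine ⟨hN', N, fun v => y (f v), fun v => ?_, fun u v huv hadj => ?_⟩
  · have h1 := real_inner_self_eq_norm_sq (y (f v))
    rw [hy, if_pos rfl] at h1
    have h2 : ‖y (f v)‖ ^ 2 = 1 := by rw [← h1]; field_simp
    have := norm_nonneg (y (f v))
    nlinarith
  · have hG : G.Adj u v := by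
      by_contra h
      exact hadj (by rw [SimpleGraph.compl_adj]; exact ⟨huv, h⟩)
    rw [hy, if_neg (hf u v hG)]
    field_simp
    ring

/-- There is a feasible `κ` for every finite graph, so `lovaszTheta` is a genuine infimum. -/
theorem exists_thetaFeasible {n : ℕ} (G : SimpleGraph (Fin n)) : ∃ κ, ThetaFeasible G κ := by
  have h := thetaFeasible_compl_of_coloring Gᶜ (n + 2) (by omega) (Fin.castLE (by omega))
    (fun u v huv h => huv.ne (Fin.castLE_injective _ h))
  rw [compl_compl] at h
  exact ⟨_, h⟩

/-- The values over which `thetaMu` takes the maximum are bounded, so it is a genuine supremum. -/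
theorem bddAbove_complThetaValues {W : Type*} (m : ℕ) (H : SimpleGraph W) :
    BddAbove (complThetaValues m H) := by
  classical
  refine ⟨((2 * m + 2 : ℕ) : ℝ), ?_⟩
  rintro t ⟨n, G, -, hm, rfl⟩
  have hcard : (Finset.univ.image fun a : G.Dart => a.fst).card ≤ 2 * m := by
    refine Finset.card_image_le.trans ?_
    rw [Finset.card_univ, G.dart_card_eq_twice_card_edges, ← hm, ← SimpleGraph.coe_edgeFinset,
      Set.ncard_coe_finset]
  set S := Finset.univ.image fun a : G.Dart => a.fst
  have hS : ∀ u v, G.Adj u v → u ∈ S := fun u v h =>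
    Finset.mem_image.2 ⟨⟨(u, v), h⟩, Finset.mem_univ _, rfl⟩
  let f : Fin n → Fin (2 * m + 2) := fun v =>
    if h : v ∈ S then Fin.castLE (by omega) (S.equivFin ⟨v, h⟩) else 0
  refine csInf_le ⟨2, fun κ hκ => hκ.1⟩
    (thetaFeasible_compl_of_coloring G (2 * m + 2) (by omega) f fun u v huv h => huv.ne ?_)
  simp only [f, dif_pos (hS u v huv), dif_pos (hS v u huv.symm)] at h
  simpa using S.equivFin.injective (Fin.castLE_injective _ h)

/-! If `κ` is infeasible for the complement of `G`, semidefinite duality yields vectors `u v` of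
norm at most one, orthogonal for distinct non-adjacent vertices, whose Gram matrix has a Rayleigh
quotient of at least `κ` (`exists_orthRep_of_not_thetaFeasible`). So it suffices to bound that
quadratic form from above. On a set coloured with `K` colours it is at most `K`. If all
neighbourhoods are `K`-colourable and the edges are oriented with out-degrees at most `D`, then
Bessel in neighbourhoods and Cauchy–Schwarz bound it by `1 + 2 * √(K * D)`
(`IsOrthRep.norm_sum_sq_le_of_orientation`).

Cycles: the edges outside the `D`-core `T` have such an orientation, and `T` has at most `2 * m / D`
vertices. Let `l` be the top eigenvalue on `T` and `x` an eigenvector. Around any vertex `v` of a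
`C_r`-free graph the distance layers below `r / 2` are `r`-colourable, and adjacent layers up to
layer `r / 2` interact with strength `O(r²)`. Hence the norm of `x` on the layers grows by a factor
of order `l / r²` per layer, so that `l ^ r * x v ^ 2 ≤ (6 * r ^ 2) ^ r * ‖x‖²`. Summing over `T`
gives `l ^ r ≤ (6 * r ^ 2) ^ r * |T|`. The choice `D ≈ m ^ (2 / (r + 2))` balances `√D` against `(m
/ D) ^ (1 / r)`.

Graphs `H` that are a forest plus a vertex: neighbourhoods in an `H`-free graph contain no copy of
the forest, so they are degenerate and have boundedly many colours. By `|T| * D ≤ 2 * m` and `|T| *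
D ≤ 2 * ex(|T|, H)`, the core is empty once `D` exceeds a multiple of `m ^ (α / (1 + α))`, and only
the orientation bound remains. This is for `α ≥ 0`; for `α < 0` an `H`-free graph has boundedly many
edges. -/

open Finset

/-! ### Semidefinite duality -/

/-- A symmetric function with nonnegative quadratic form is a Gram matrix. -/
theorem exists_gram_vectors {V : Type*} [Fintype V] (X : V → V → ℝ)
    (hsymm : ∀ a b, X a b = X b a) (hpos : ∀ y : V → ℝ, 0 ≤ ∑ a, ∑ b, y a * y b * X a b) :
    ∃ (m : ℕ) (x : V → EuclideanSpace ℝ (Fin m)), ∀ a b, inner ℝ (x a) (x b) = X a b := by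
  have hM : (Matrix.of X).PosSemidef := by
    rw [Matrix.posSemidef_iff_dotProduct_mulVec]
    refine ⟨Matrix.IsHermitian.ext fun a b => by simp [hsymm a b], fun y => ?_⟩
    refine (hpos y).trans_eq ?_
    simp only [dotProduct, Matrix.mulVec, Finset.mul_sum, Pi.star_apply, star_trivial,
      Matrix.of_apply]
    exact sum_congr rfl fun a _ => sum_congr rfl fun b _ => by ring
  obtain ⟨m, v, hv⟩ := Matrix.posSemidef_iff_eq_sum_vecMulVec.1 hM
  refine ⟨m, fun a => WithLp.toLp 2 fun i => v i a, fun a b => ?_⟩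
  have h := congrFun (congrFun hv a) b
  simp only [Matrix.of_apply, Matrix.sum_apply, Matrix.vecMulVec_apply,
    star_trivial] at h
  rw [h, PiLp.inner_apply]
  exact sum_congr rfl fun i _ => by simp [mul_comm]

/-- Vectors of norm at most one such that distinct non-adjacent vertices get orthogonal vectors. -/
structure IsOrthRep {V E : Type*} [NormedAddCommGroup E] [InnerProductSpace ℝ E]
    (G : SimpleGraph V) (u : V → E) : Prop where
  norm_le : ∀ v, ‖u v‖ ≤ 1
  inner_eq_zero : ∀ a b, a ≠ b → ¬ G.Adj a b → inner ℝ (u a) (u b) = 0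

/-- Symmetric positive semidefinite functions with trace `t`. -/
def psdTrace (V : Type*) [Fintype V] (t : ℝ) : Set (V × V → ℝ) :=
  {X | (∀ a b, X (a, b) = X (b, a)) ∧ (∀ y : V → ℝ, 0 ≤ ∑ a, ∑ b, y a * y b * X (a, b)) ∧
    ∑ a, X (a, a) = t}

theorem convex_psdTrace (V : Type*) [Fintype V] (t : ℝ) : Convex ℝ (psdTrace V t) := by
  rintro X ⟨h1, h2, h3⟩ Y ⟨k1, k2, k3⟩ p q hp hq hpq
  refine ⟨fun a b => by simp [h1 a b, k1 a b], fun y => ?_, ?_⟩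
  · have := add_nonneg (mul_nonneg hp (h2 y)) (mul_nonneg hq (k2 y))
    refine this.trans_eq ?_
    simp only [mul_sum, ← sum_add_distrib, Pi.add_apply, Pi.smul_apply, smul_eq_mul]
    exact sum_congr rfl fun a _ => sum_congr rfl fun b _ => by ring
  · simp only [Pi.add_apply, Pi.smul_apply, smul_eq_mul, sum_add_distrib, ← mul_sum, h3, k3]
    rw [← add_mul, hpq, one_mul]

/-- In a Gram representation the trace bounds every squared norm, so by Cauchy–Schwarz all entries
lie in `[-t, t]`. -/
theorem isCompact_psdTrace (V : Type*) [Fintype V] (t : ℝ) : IsCompact (psdTrace V t) := by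
  classical
  have hclosed : IsClosed (psdTrace V t) := by
    have h1 : IsClosed {X : V × V → ℝ | ∀ a b, X (a, b) = X (b, a)} := by
      simp only [Set.ofPred_forall]
      exact isClosed_iInter fun a => isClosed_iInter fun b =>
        isClosed_eq (by fun_prop) (by fun_prop)
    have h2 : IsClosed {X : V × V → ℝ | ∀ y : V → ℝ, 0 ≤ ∑ a, ∑ b, y a * y b * X (a, b)} := by
      simp only [Set.ofPred_forall]
      exact isClosed_iInter fun y => isClosed_le (by fun_prop) (by fun_prop)
    have h3 : IsClosed {X : V × V → ℝ | ∑ a, X (a, a) = t} :=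
      isClosed_eq (by fun_prop) (by fun_prop)
    exact h1.inter (h2.inter h3)
  refine IsCompact.of_isClosed_subset
    (isCompact_univ_pi fun _ : V × V => isCompact_Icc (a := -t) (b := t)) hclosed ?_
  rintro X ⟨hs, hp, ht⟩ ⟨a, b⟩ -
  obtain ⟨m, x, hx⟩ := exists_gram_vectors (fun a b => X (a, b)) hs hp
  have hn : ∀ a, ‖x a‖ ^ 2 = X (a, a) := fun a => by rw [← hx, real_inner_self_eq_norm_sq]
  have hle : ∀ a, ‖x a‖ ^ 2 ≤ t := fun a => by
    rw [← ht]
    simp only [← hn]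
    exact single_le_sum (f := fun a => ‖x a‖ ^ 2) (fun _ _ => by positivity) (mem_univ a)
  have h1 := abs_real_inner_le_norm (x a) (x b)
  rw [hx] at h1
  rw [Set.mem_Icc, ← abs_le]
  nlinarith [hle a, hle b, sq_nonneg (‖x a‖ - ‖x b‖)]

/-- A linear form on functions of pairs that is positive on the defects of all trace-normalised
positive semidefinite functions from feasibility of `κ`. -/
theorem exists_separating_form {V : Type*} [Fintype V] [DecidableEq V] (G : SimpleGraph V)
    [DecidableRel G.Adj] {κ : ℝ} (h2 : 2 ≤ κ) (hκ : ¬ ThetaFeasible Gᶜ κ) :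
    ∃ g : V × V → ℝ, ∀ y : V → ℝ, ∑ a, y a ^ 2 = Fintype.card V →
      0 < ∑ a, ∑ b, (if a = b then y a * y b - 1 else
        if G.Adj a b then y a * y b + 1 / (κ - 1) else 0) * g (a, b) := by
  -- `L X` records by how much `X` misses the unit norms and the prescribed inner products on edges
  -- of `G`; the other entries are unconstrained. `L` is affine, so the image of the compact convex
  -- set is compact and convex, and it misses `0` because `κ` is infeasible.
  set L : (V × V → ℝ) → (V × V → ℝ) := fun X p => if p.1 = p.2 then X p - 1 else
    if G.Adj p.1 p.2 then X p + 1 / (κ - 1) else 0 with hL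
  have hcont : Continuous L := by
    refine continuous_pi fun p => ?_
    simp only [hL]
    split_ifs <;> fun_prop
  have hcomp := (isCompact_psdTrace V (Fintype.card V : ℝ)).image hcont
  have hconv : Convex ℝ (L '' psdTrace V (Fintype.card V : ℝ)) := by
    rintro _ ⟨X, hX, rfl⟩ _ ⟨Y, hY, rfl⟩ p q hp hq hpq
    refine ⟨_, convex_psdTrace V _ hX hY hp hq hpq, ?_⟩
    have hq' : q = 1 - p := by linarith
    funext c
    simp only [hL, Pi.add_apply, Pi.smul_apply, smul_eq_mul]
    split_ifs
    · rw [hq']; ring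
    · rw [hq']; ring
    · simp
  have hzero : (0 : V × V → ℝ) ∉ L '' psdTrace V (Fintype.card V : ℝ) := by
    rintro ⟨X, ⟨hs, hp, ht⟩, h0⟩
    obtain ⟨m, x, hx⟩ := exists_gram_vectors (fun a b => X (a, b)) hs hp
    refine hκ ⟨h2, m, x, fun v => ?_, fun a b hab hadj => ?_⟩
    · have h := congrFun h0 (v, v)
      simp only [hL, if_true, Pi.zero_apply] at h
      have h1 : ‖x v‖ ^ 2 = 1 := by rw [← real_inner_self_eq_norm_sq, hx]; linarith
      exact (pow_eq_one_iff_of_nonneg (norm_nonneg _) two_ne_zero).1 h1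
    · have hG : G.Adj a b := by
        by_contra h
        exact hadj (by rw [SimpleGraph.compl_adj]; exact ⟨hab, h⟩)
      have h := congrFun h0 (a, b)
      simp only [hL, if_neg hab, if_pos hG, Pi.zero_apply] at h
      rw [hx, neg_div]
      linarith
  obtain ⟨f, s, hf0, hfs⟩ := geometric_hahn_banach_point_closed hconv hcomp.isClosed hzero
  refine ⟨fun p => f (Pi.single p 1), fun y hy => ?_⟩
  -- The separating functional is evaluated only at the rank-one matrices given by `y a * y b`.
  have hmem : (fun p : V × V => y p.1 * y p.2) ∈ psdTrace V (Fintype.card V : ℝ) := by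
    refine ⟨fun a b => mul_comm _ _, fun z => ?_, by rw [← hy]; exact sum_congr rfl fun a _ => by ring⟩
    have : ∑ a, ∑ b, z a * z b * (y a * y b) = (∑ a, z a * y a) ^ 2 := by
      rw [sq, sum_mul_sum]
      exact sum_congr rfl fun a _ => sum_congr rfl fun b _ => by ring
    rw [this]
    positivity
  have h := hfs _ ⟨_, hmem, rfl⟩
  rw [map_zero] at hf0
  have h' := (hf0.trans h)
  have key : ∀ z : V × V → ℝ, f z = ∑ p, z p * f (Pi.single p 1) := fun z => by
    have := LinearMap.pi_apply_eq_sum_univ (f : (V × V → ℝ) →ₗ[ℝ] ℝ) z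
    simp only [ContinuousLinearMap.coe_coe, smul_eq_mul] at this
    rw [this]
    refine sum_congr rfl fun p _ => ?_
    congr 2
    funext q
    simp [Pi.single_apply, eq_comm]
  rw [key, Fintype.sum_prod_type] at h'
  exact h'

/-- Semidefinite duality: if `κ` is infeasible for the complement of `G`, there is an orthonormal
representation whose Gram matrix has a Rayleigh quotient of at least `κ`. -/
theorem exists_orthRep_of_not_thetaFeasible {V : Type*} [Fintype V] [Nonempty V]
    (G : SimpleGraph V) {κ : ℝ} (h2 : 2 ≤ κ) (hκ : ¬ ThetaFeasible Gᶜ κ) :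
    ∃ (m : ℕ) (u : V → EuclideanSpace ℝ (Fin m)) (y : V → ℝ), IsOrthRep G u ∧
      0 < ∑ v, y v ^ 2 ∧ κ * ∑ v, y v ^ 2 ≤ ‖∑ v, y v • u v‖ ^ 2 := by
  classical
  obtain ⟨g, hg⟩ := exists_separating_form G h2 hκ
  have hκ1 : κ - 1 ≠ 0 := by linarith
  set N : ℝ := (Fintype.card V : ℝ) with hN
  have hNpos : 0 < N := by rw [hN]; exact_mod_cast Fintype.card_pos
  set B : V → V → ℝ := fun a b => if a = b then 0 else if G.Adj a b then g (a, b) else 0 with hB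
  set β : ℝ := ∑ a, ∑ b, B a b with hβ
  set δ : ℝ := ∑ a, g (a, a) with hδ
  -- The separating form is a quadratic form plus the constant `β / (κ - 1) - δ`. On the sphere `∑ y
  -- ^ 2 = N`, adding `c` to the diagonal absorbs this constant.
  set c : ℝ := (β / (κ - 1) - δ) / N with hc
  set Z : V → V → ℝ := fun a b => (B a b + B b a) / 2 + if a = b then g (a, a) + c else 0 with hZ
  have hquad : ∀ y : V → ℝ, ∑ a, ∑ b, y a * y b * Z a b =
      ∑ a, ∑ b, y a * y b * B a b + ∑ a, y a ^ 2 * (g (a, a) + c) := by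
    intro y
    have e1 : ∑ a, ∑ b, y a * y b * B b a = ∑ a, ∑ b, y a * y b * B a b := by
      rw [sum_comm]
      exact sum_congr rfl fun a _ => sum_congr rfl fun b _ => by ring
    have e2 : ∑ a, ∑ b, y a * y b * Z a b = (∑ a, ∑ b, y a * y b * B a b) / 2 +
        (∑ a, ∑ b, y a * y b * B b a) / 2 +
        ∑ a, ∑ b, (if a = b then y a * y b * (g (a, a) + c) else 0) := by
      simp only [sum_div, ← sum_add_distrib]
      refine sum_congr rfl fun a _ => sum_congr rfl fun b _ => ?_
      simp only [hZ]
      split_ifs <;> ring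
    rw [e2, e1]
    simp only [sum_ite_eq, mem_univ, if_true]
    rw [add_halves]
    congr 1
    exact sum_congr rfl fun a _ => by ring
  have hnorm : ∀ y : V → ℝ, ∑ a, y a ^ 2 = N → 0 < ∑ a, ∑ b, y a * y b * Z a b := by
    intro y hy
    refine (hg y hy).trans_eq ?_
    rw [hquad]
    have e1 : ∀ a b, (if a = b then y a * y b - 1 else
        if G.Adj a b then y a * y b + 1 / (κ - 1) else 0) * g (a, b) =
        (y a * y b * B a b + B a b / (κ - 1)) +
          if a = b then (y a ^ 2 - 1) * g (a, a) else 0 := by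
      intro a b
      simp only [hB]
      by_cases hab : a = b
      · subst hab; simp only [if_true]; ring
      · by_cases hG : G.Adj a b
        · simp [hab, hG]; ring
        · simp [hab, hG]
    simp only [e1, sum_add_distrib, sum_ite_eq, mem_univ, if_true, ← sum_div, mul_add, sub_mul,
      one_mul, sum_sub_distrib, ← sum_mul, hy]
    have : N * c = β / (κ - 1) - δ := by rw [hc]; field_simp
    rw [this]
    ring
  have hsymm : ∀ a b, Z a b = Z b a := by
    intro a b
    simp only [hZ]
    by_cases hab : a = b
    · subst hab; rfl
    · rw [if_neg hab, if_neg (Ne.symm hab)]; ring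
  have hpos : ∀ y : V → ℝ, 0 ≤ ∑ a, ∑ b, y a * y b * Z a b := by
    intro y
    by_cases h0 : ∑ a, y a ^ 2 = 0
    · have : ∀ a, y a = 0 := fun a => by
        have := (sum_eq_zero_iff_of_nonneg (fun a _ => sq_nonneg (y a))).1 h0 a (mem_univ a)
        exact pow_eq_zero_iff (two_ne_zero) |>.1 this
      simp [this]
    · have hs : 0 < ∑ a, y a ^ 2 :=
        lt_of_le_of_ne (sum_nonneg fun a _ => sq_nonneg _) (Ne.symm h0)
      set t := Real.sqrt (N / ∑ a, y a ^ 2)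
      have ht : t ^ 2 = N / ∑ a, y a ^ 2 := Real.sq_sqrt (by positivity)
      have htpos : 0 < t ^ 2 := by rw [ht]; positivity
      have h := hnorm (fun a => t * y a) (by
        simp only [mul_pow, ← mul_sum, ht]; field_simp)
      have e : ∑ a, ∑ b, t * y a * (t * y b) * Z a b = t ^ 2 * ∑ a, ∑ b, y a * y b * Z a b := by
        simp only [mul_sum]
        exact sum_congr rfl fun a _ => sum_congr rfl fun b _ => by ring
      rw [e] at h
      exact (pos_of_mul_pos_right h htpos.le).le
  obtain ⟨m, b, hb⟩ := exists_gram_vectors Z hsymm hpos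
  have hbn : ∀ v, ‖b v‖ ^ 2 = Z v v := fun v => by rw [← hb, real_inner_self_eq_norm_sq]
  have htr : ∑ v, ‖b v‖ ^ 2 = β / (κ - 1) := by
    simp only [hbn, hZ, if_true, hB]
    simp only [add_zero, zero_div, zero_add, sum_add_distrib, sum_const, card_univ, nsmul_eq_mul]
    rw [← hN, ← hδ]
    have : N * c = β / (κ - 1) - δ := by rw [hc]; field_simp
    rw [this]; ring
  have hJ : ‖∑ v, b v‖ ^ 2 = ∑ a, ∑ b, Z a b := by
    rw [← real_inner_self_eq_norm_sq, sum_inner]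
    simp only [inner_sum, hb]
  -- The trace of `Z` is `β / (κ - 1)` and the entries off the diagonal add up to `β`, so the sum of
  -- all entries is exactly `κ` times the trace.
  have hJ' : ∑ a, ∑ b, Z a b = κ * ∑ v, ‖b v‖ ^ 2 := by
    have h := hquad fun _ => 1
    simp only [one_mul, mul_one, one_pow, sum_add_distrib, sum_const, card_univ,
      nsmul_eq_mul] at h
    have : N * c = β / (κ - 1) - δ := by rw [hc]; field_simp
    rw [h, ← hN, ← hδ, this, htr, ← hβ]
    field_simp
    ring
  have hJpos : 0 < ∑ a, ∑ b, Z a b := by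
    have := hnorm (fun _ => 1) (by simp [hN])
    simpa using this
  -- A vanishing `b v` stays zero after normalisation, since `0⁻¹ = 0`; hence norms at most one
  -- rather than unit norms.
  have hy : ∀ v, ‖b v‖ • (‖b v‖⁻¹ • b v) = b v := by
    intro v
    by_cases h : b v = 0
    · simp [h]
    · rw [smul_smul, mul_inv_cancel₀ (norm_ne_zero_iff.2 h), one_smul]
  refine ⟨m, fun v => ‖b v‖⁻¹ • b v, fun v => ‖b v‖, ⟨fun v => ?_, fun p q hpq hadj => ?_⟩, ?_, ?_⟩
  · rw [norm_smul, norm_inv, norm_norm]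
    exact inv_mul_le_one
  · rw [inner_smul_left, inner_smul_right, hb]
    have hadj' : ¬ G.Adj q p := fun h => hadj h.symm
    simp [hZ, hB, hpq, hpq.symm, hadj, hadj']
  · rw [hJ'] at hJpos
    exact pos_of_mul_pos_right hJpos (by linarith)
  · simp only [hy]
    rw [hJ, hJ']

/-! ### Quadratic forms of orthonormal representations -/

section OrthRep

variable {V E : Type*} [NormedAddCommGroup E] [InnerProductSpace ℝ E]
  {G : SimpleGraph V} {u : V → E}

theorem IsOrthRep.indicator (hu : IsOrthRep G u) (T : Finset V) [DecidableEq V] :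
    IsOrthRep G fun v => if v ∈ T then u v else 0 := by
  refine ⟨fun v => ?_, fun a b hab h => ?_⟩
  · split_ifs
    · exact hu.norm_le v
    · simp
  · split_ifs <;> simp [hu.inner_eq_zero a b hab h]

/-- A maximiser of the Rayleigh quotient of the Gram matrix of `u` is an eigenvector. -/
theorem exists_top_eigenvector [Fintype V] [Nonempty V] (u : V → E) :
    ∃ (x : V → ℝ) (l : ℝ), 0 ≤ l ∧ 0 < ∑ v, x v ^ 2 ∧
      (∀ v, inner ℝ (u v) (∑ w, x w • u w) = l * x v) ∧
      ∀ y : V → ℝ, ‖∑ v, y v • u v‖ ^ 2 ≤ l * ∑ v, y v ^ 2 := by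
  classical
  have hcont : Continuous fun y : V → ℝ => ‖∑ v, y v • u v‖ ^ 2 := by fun_prop
  let S : Set (V → ℝ) := {y | ∑ v, y v ^ 2 = 1}
  have hS : IsCompact S := by
    refine IsCompact.of_isClosed_subset
      (isCompact_univ_pi fun _ : V => isCompact_Icc (a := (-1 : ℝ)) (b := 1))
      (isClosed_eq (by fun_prop) (by fun_prop)) ?_
    intro y (hy : ∑ v, y v ^ 2 = 1) v _
    rw [Set.mem_Icc, ← abs_le, ← sq_le_one_iff_abs_le_one, ← hy]
    exact single_le_sum (f := fun v => y v ^ 2) (fun _ _ => sq_nonneg _) (mem_univ v)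
  have hne : S.Nonempty := by
    obtain ⟨v⟩ := ‹Nonempty V›
    exact ⟨Pi.single v 1, by simp [S, Pi.single_apply, ite_pow]⟩
  obtain ⟨x, hx, hmax⟩ := hS.exists_isMaxOn hne hcont.continuousOn
  replace hx : ∑ v, x v ^ 2 = 1 := hx
  set l := ‖∑ v, x v • u v‖ ^ 2 with hl
  have hall : ∀ y : V → ℝ, ‖∑ v, y v • u v‖ ^ 2 ≤ l * ∑ v, y v ^ 2 := by
    intro y
    by_cases h0 : ∑ v, y v ^ 2 = 0
    · have : ∀ v, y v = 0 := fun a => by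
        have := (sum_eq_zero_iff_of_nonneg (fun a _ => sq_nonneg (y a))).1 h0 a (mem_univ a)
        exact pow_eq_zero_iff (two_ne_zero) |>.1 this
      simp [this]
    · have hs : 0 < ∑ v, y v ^ 2 :=
        lt_of_le_of_ne (sum_nonneg fun a _ => sq_nonneg _) (Ne.symm h0)
      set t := Real.sqrt (∑ v, y v ^ 2)
      have ht : t ^ 2 = ∑ v, y v ^ 2 := Real.sq_sqrt hs.le
      have htpos : 0 < t := Real.sqrt_pos.2 hs
      have hmem : (fun v => t⁻¹ * y v) ∈ S := by
        simp only [S, Set.mem_ofPred_eq, mul_pow, ← mul_sum, ← ht]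
        field_simp
      have h := hmax hmem
      simp only [Set.mem_ofPred_eq, mul_smul, ← smul_sum, norm_smul, mul_pow, norm_inv,
        Real.norm_of_nonneg htpos.le, ← hl] at h
      rw [← ht]
      rw [inv_pow, inv_mul_le_iff₀ (by positivity)] at h
      linarith
  refine ⟨x, l, by positivity, by rw [hx]; exact one_pos, fun v => ?_, hall⟩
  set c := ∑ w, x w • u w with hc
  -- the first variation in the direction of a vertex vanishes
  have hvar : ∀ ε : ℝ, 2 * ε * (inner ℝ (u v) c - l * x v) + ε ^ 2 * (‖u v‖ ^ 2 - l) ≤ 0 := by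
    intro ε
    have h := hall fun w => x w + if w = v then ε else 0
    have e1 : ∑ w, (x w + if w = v then ε else 0) • u w = c + ε • u v := by
      simp [add_smul, sum_add_distrib, ite_smul, hc]
    have e2 : ∑ w, (x w + if w = v then ε else 0) ^ 2 = 1 + 2 * ε * x v + ε ^ 2 := by
      have : ∀ w, (x w + if w = v then ε else 0) ^ 2 =
          x w ^ 2 + if w = v then 2 * ε * x w + ε ^ 2 else 0 := by
        intro w; split_ifs <;> ring
      simp only [this, sum_add_distrib, hx, sum_ite_eq', mem_univ, if_true]
      ring
    rw [e1, e2, norm_add_sq_real, inner_smul_right, norm_smul, real_inner_comm, mul_pow,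
      Real.norm_eq_abs, sq_abs, ← hl] at h
    linarith
  by_contra hne
  set d := inner ℝ (u v) c - l * x v with hd
  have hd0 : d ≠ 0 := sub_ne_zero.2 hne
  set q := ‖u v‖ ^ 2 - l
  -- At this `ε` the linear term dominates the quadratic one, so the variation is positive unless `d
  -- = 0`.
  have h := hvar (d / (|q| + 1))
  have hq : 0 < |q| + 1 := by positivity
  have e : 2 * (d / (|q| + 1)) * d + (d / (|q| + 1)) ^ 2 * q =
      d ^ 2 * (2 * (|q| + 1) + q) / (|q| + 1) ^ 2 := by
    field_simp
  rw [e] at h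
  have : 0 < d ^ 2 * (2 * (|q| + 1) + q) / (|q| + 1) ^ 2 := by
    have := neg_abs_le q
    have h3 : 0 < d ^ 2 := by positivity
    have h4 : 0 < 2 * (|q| + 1) + q := by linarith [abs_nonneg q]
    positivity
  linarith

/-- Pythagoras and Bessel for vectors of norm at most one indexed by an independent set. -/

theorem IsOrthRep.norm_sum_sq_le_of_indep (hu : IsOrthRep G u) (S : Finset V)
    (hS : ∀ a ∈ S, ∀ b ∈ S, ¬ G.Adj a b) (y : V → ℝ) :
    ‖∑ v ∈ S, y v • u v‖ ^ 2 ≤ ∑ v ∈ S, y v ^ 2 := by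
  rw [← real_inner_self_eq_norm_sq, sum_inner]
  refine sum_le_sum fun a ha => ?_
  rw [inner_sum, sum_eq_single_of_mem a ha]
  · rw [inner_smul_left, inner_smul_right, real_inner_self_eq_norm_sq]
    simp only [conj_trivial]
    have h1 : ‖u a‖ ^ 2 ≤ 1 := pow_le_one₀ (norm_nonneg _) (hu.norm_le a)
    nlinarith [sq_nonneg (y a)]
  · intro b hb hba
    rw [inner_smul_left, inner_smul_right, hu.inner_eq_zero a b hba.symm (hS a ha b hb)]
    simp

/-- The quadratic form of an orthonormal representation on a set coloured with `K` colours. -/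
theorem IsOrthRep.norm_sum_sq_le_of_coloring (hu : IsOrthRep G u) (S : Finset V) {K : ℕ}
    (f : V → Fin K) (hf : ∀ a ∈ S, ∀ b ∈ S, G.Adj a b → f a ≠ f b) (y : V → ℝ) :
    ‖∑ v ∈ S, y v • u v‖ ^ 2 ≤ K * ∑ v ∈ S, y v ^ 2 := by
  classical
  rw [← sum_fiberwise S f, ← sum_fiberwise S f (fun v => y v ^ 2)]
  have h1 : ‖∑ j, ∑ v ∈ S with f v = j, y v • u v‖ ^ 2 ≤
      (∑ j, ‖∑ v ∈ S with f v = j, y v • u v‖) ^ 2 :=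
    pow_le_pow_left₀ (norm_nonneg _) (norm_sum_le _ _) 2
  have h2 := sq_sum_le_card_mul_sum_sq (s := (univ : Finset (Fin K)))
    (f := fun j => ‖∑ v ∈ S with f v = j, y v • u v‖)
  rw [card_univ, Fintype.card_fin] at h2
  refine h1.trans (h2.trans (mul_le_mul_of_nonneg_left (sum_le_sum fun j _ => ?_) (by positivity)))
  refine hu.norm_sum_sq_le_of_indep _ (fun a ha b hb hab => ?_) y
  rw [mem_filter] at ha hb
  exact hf a ha.1 b hb.1 hab (ha.2.trans hb.2.symm)

/-- This is the dual of the preceding bound: for the coefficients `⟪u v, z⟫`, Cauchy–Schwarz against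
`z` gives `A ^ 2 ≤ K * A * ‖z‖ ^ 2`, and one factor `A` cancels. -/
theorem IsOrthRep.sum_inner_sq_le_of_coloring (hu : IsOrthRep G u) (S : Finset V) {K : ℕ}
    (f : V → Fin K) (hf : ∀ a ∈ S, ∀ b ∈ S, G.Adj a b → f a ≠ f b) (z : E) :
    ∑ v ∈ S, inner ℝ (u v) z ^ 2 ≤ K * ‖z‖ ^ 2 := by
  set y : V → ℝ := fun v => inner ℝ (u v) z
  have h := hu.norm_sum_sq_le_of_coloring S f hf y
  set A := ∑ v ∈ S, y v ^ 2 with hA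
  have hA0 : 0 ≤ A := sum_nonneg fun _ _ => sq_nonneg _
  have e : inner ℝ (∑ v ∈ S, y v • u v) z = A := by
    rw [sum_inner]
    exact sum_congr rfl fun v _ => by rw [inner_smul_left]; simp [y, sq]
  have h2 := abs_real_inner_le_norm (∑ v ∈ S, y v • u v) z
  rw [e, abs_of_nonneg hA0] at h2
  have h3 : A ^ 2 ≤ (K * A) * ‖z‖ ^ 2 := by
    calc A ^ 2 ≤ (‖∑ v ∈ S, y v • u v‖ * ‖z‖) ^ 2 := pow_le_pow_left₀ hA0 h2 2
      _ = ‖∑ v ∈ S, y v • u v‖ ^ 2 * ‖z‖ ^ 2 := mul_pow _ _ _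
      _ ≤ _ := mul_le_mul_of_nonneg_right h (by positivity)
  by_contra hlt
  push Not at hlt
  have : 0 < A := lt_of_le_of_lt (by positivity) hlt
  nlinarith

/-- Every vertex neighbourhood can be properly coloured with `K` colours. -/
def LocallyColorable (G : SimpleGraph V) (K : ℕ) : Prop :=
  ∀ v, ∃ f : V → Fin K, ∀ a b, G.Adj v a → G.Adj v b → G.Adj a b → f a ≠ f b

theorem IsOrthRep.sum_inner_sq_le_of_locallyColorable (hu : IsOrthRep G u) {K : ℕ}
    (hK : LocallyColorable G K) (v : V) (S : Finset V) (hS : ∀ w ∈ S, G.Adj v w) :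
    ∑ w ∈ S, inner ℝ (u v) (u w) ^ 2 ≤ K := by
  obtain ⟨f, hf⟩ := hK v
  have h := hu.sum_inner_sq_le_of_coloring S f (fun a ha b hb => hf a b (hS a ha) (hS b hb)) (u v)
  simp only [real_inner_comm] at h ⊢
  refine h.trans (mul_le_of_le_one_right (by positivity) (pow_le_one₀ (norm_nonneg _) (hu.norm_le v)))

/-- The bilinear form of the Gram matrix along oriented edges, when out-degrees are bounded and
the graph is locally colourable. -/
theorem IsOrthRep.oriented_sum_le (hu : IsOrthRep G u) {K D : ℕ} (hK : LocallyColorable G K)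
    (o : V → V → Prop) [∀ a, DecidablePred (o a)] (hadj : ∀ a b, o a b → G.Adj a b)
    (S T : Finset V) (hD : ∀ a ∈ S, #{b ∈ T | o a b} ≤ D) (x : V → ℝ) :
    ∑ a ∈ S, ∑ b ∈ T with o a b, |inner ℝ (u a) (u b) * x a * x b| ≤
      √(K * D) * (√(∑ a ∈ S, x a ^ 2) * √(∑ b ∈ T, x b ^ 2)) := by
  classical
  have hsq : ∀ S : Finset V, 0 ≤ ∑ a ∈ S, x a ^ 2 := fun S => sum_nonneg fun _ _ => sq_nonneg _
  rw [← Real.sqrt_mul (hsq S), ← Real.sqrt_mul (by positivity)]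
  refine Real.le_sqrt_of_sq_le ?_
  have e : ∀ h : V → V → ℝ, ∑ a ∈ S, ∑ b ∈ T with o a b, h a b =
      ∑ p ∈ S ×ˢ T with o p.1 p.2, h p.1 p.2 := by
    intro h
    rw [sum_filter, sum_product]
    exact sum_congr rfl fun a _ => sum_filter _ _
  rw [e]
  -- The factor `|x a|` is controlled by the out-degree of `a`, the factor `|⟪u a, u b⟫ * x b|` by
  -- Bessel in the neighbourhood of `b`.
  have hcs := sum_mul_sq_le_sq_mul_sq ({p ∈ S ×ˢ T | o p.1 p.2}) (fun p => |x p.1|)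
    (fun p => |inner ℝ (u p.1) (u p.2) * x p.2|)
  have e1 : ∑ p ∈ S ×ˢ T with o p.1 p.2, |inner ℝ (u p.1) (u p.2) * x p.1 * x p.2| =
      ∑ p ∈ S ×ˢ T with o p.1 p.2, |x p.1| * |inner ℝ (u p.1) (u p.2) * x p.2| := by
    refine sum_congr rfl fun p _ => ?_
    rw [← abs_mul]; congr 1; ring
  rw [e1]
  refine hcs.trans ?_
  have b1 : ∑ p ∈ S ×ˢ T with o p.1 p.2, |x p.1| ^ 2 ≤ D * ∑ a ∈ S, x a ^ 2 := by
    rw [← e (fun a _ => |x a| ^ 2), mul_sum]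
    refine sum_le_sum fun a ha => ?_
    rw [sum_const, nsmul_eq_mul, sq_abs]
    exact mul_le_mul_of_nonneg_right (by exact_mod_cast hD a ha) (sq_nonneg _)
  have b2 : ∑ p ∈ S ×ˢ T with o p.1 p.2, |inner ℝ (u p.1) (u p.2) * x p.2| ^ 2 ≤
      K * ∑ b ∈ T, x b ^ 2 := by
    rw [sum_filter, sum_product_right, mul_sum]
    refine sum_le_sum fun b _ => ?_
    rw [← sum_filter]
    have h := hu.sum_inner_sq_le_of_locallyColorable hK b {a ∈ S | o a b} (fun a ha =>
      (hadj a b (mem_filter.1 ha).2).symm)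
    calc ∑ a ∈ S with o a b, |inner ℝ (u a) (u b) * x b| ^ 2
        = (∑ a ∈ S with o a b, inner ℝ (u b) (u a) ^ 2) * x b ^ 2 := by
          rw [sum_mul]
          exact sum_congr rfl fun a _ => by rw [sq_abs, real_inner_comm]; ring
      _ ≤ _ := mul_le_mul_of_nonneg_right h (sq_nonneg _)
  calc _ ≤ (D * ∑ a ∈ S, x a ^ 2) * (K * ∑ b ∈ T, x b ^ 2) :=
        mul_le_mul b1 b2 (sum_nonneg fun _ _ => sq_nonneg _) (mul_nonneg (by positivity) (hsq S))
    _ = _ := by ring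

end OrthRep

/-! ### Ancestral lines, cycles, and colourings of distance layers -/

section Cycles

variable {V : Type*} {G : SimpleGraph V}

theorem cycleGraph_isContained_of_injOn {r : ℕ} (hr : 2 ≤ r) (g : ℕ → V)
    (hinj : ∀ i j, i < r → j < r → g i = g j → i = j)
    (hadj : ∀ i, i + 1 < r → G.Adj (g i) (g (i + 1))) (hlast : G.Adj (g (r - 1)) (g 0)) :
    (SimpleGraph.cycleGraph r).IsContained G := by
  have key : ∀ a b : Fin r, (b - a).val = 1 → G.Adj (g a) (g b) := by
    intro a b hab
    rw [Fin.sub_def] at hab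
    simp only at hab
    have ha := a.isLt
    have hb := b.isLt
    by_cases hle : b.val < a.val
    · have h1 : r - a + b < r := by omega
      rw [Nat.mod_eq_of_lt h1] at hab
      have h2 : a.val = r - 1 := by omega
      have h3 : b.val = 0 := by omega
      rw [h2, h3]
      exact hlast
    · have h1 : r - a + b = (b.val - a.val) + r := by omega
      rw [h1, Nat.add_mod_right, Nat.mod_eq_of_lt (by omega)] at hab
      have h2 : b.val = a.val + 1 := by omega
      rw [h2]
      exact hadj _ (by omega)
  refine ⟨⟨⟨fun i => g i, fun {a b} h => ?_⟩, fun a b h => Fin.ext (hinj _ _ a.2 b.2 h)⟩⟩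
  rcases SimpleGraph.cycleGraph_adj'.1 h with h | h
  · exact (key b a h).symm
  · exact key a b h

/-- `d` is a distance function from a root, and `p` maps each vertex to a neighbour one step closer
to the root. -/
structure IsParentMap (G : SimpleGraph V) (d : V → ℕ∞) (p : V → V) : Prop where
  root_unique : ∀ a b, d a = 0 → d b = 0 → a = b
  parent : ∀ w (i : ℕ), d w = ((i + 1 : ℕ) : ℕ∞) → G.Adj (p w) w ∧ d (p w) = i

theorem exists_isParentMap (G : SimpleGraph V) (v : V) : ∃ p, IsParentMap G (G.edist v) p := by
  classical
  have h : ∀ w, ∃ q, ∀ i : ℕ, G.edist v w = ((i + 1 : ℕ) : ℕ∞) → G.Adj q w ∧ G.edist v q = i := by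
    intro w
    by_cases hw : ∃ i : ℕ, G.edist v w = ((i + 1 : ℕ) : ℕ∞)
    · obtain ⟨i, hi⟩ := hw
      obtain ⟨q, hq⟩ := SimpleGraph.exists_walk_of_edist_eq_coe hi
      have hnil : ¬ q.Nil := by
        intro hn
        rw [← SimpleGraph.Walk.length_eq_zero_iff] at hn
        omega
      refine ⟨q.penultimate, fun j hj => ?_⟩
      have hij : i = j := by
        rw [hi] at hj
        have := Nat.cast_injective (R := ℕ∞) hj
        omega
      subst hij
      have hadj := q.adj_penultimate hnil
      refine ⟨hadj, le_antisymm ?_ ?_⟩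
      · have := SimpleGraph.edist_le q.dropLast
        refine this.trans ?_
        have hl : q.dropLast.length ≤ i := by
          simp [SimpleGraph.Walk.dropLast, hq]
        exact_mod_cast hl
      · have h1 := SimpleGraph.edist_triangle (G := G) (u := v) (v := q.penultimate) (w := w)
        rw [hi, SimpleGraph.edist_eq_one_iff_adj.2 hadj, Nat.cast_add, Nat.cast_one] at h1
        exact (ENat.add_le_add_iff_right ENat.one_ne_top).1 h1
    · exact ⟨w, fun i hi => absurd ⟨i, hi⟩ hw⟩
  choose p hp using h
  refine ⟨p, ⟨fun a b ha hb => ?_, hp⟩⟩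
  rw [SimpleGraph.edist_eq_zero_iff] at ha hb
  exact ha.symm.trans hb

variable {d : V → ℕ∞} {p : V → V}

theorem IsParentMap.iterate (h : IsParentMap G d p) {w : V} {i : ℕ} (hw : d w = i) (t : ℕ)
    (ht : t ≤ i) : d (p^[t] w) = ((i - t : ℕ) : ℕ∞) := by
  induction t with
  | zero => simpa using hw
  | succ t ih =>
    rw [Function.iterate_succ_apply']
    refine (h.parent _ (i - (t + 1)) ?_).2
    rw [ih (by omega)]
    congr 1
    omega

theorem IsParentMap.adj_iterate (h : IsParentMap G d p) {w : V} {i : ℕ} (hw : d w = i) (t : ℕ)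
    (ht : t < i) : G.Adj (p^[t + 1] w) (p^[t] w) := by
  rw [Function.iterate_succ_apply']
  refine (h.parent _ (i - (t + 1)) ?_).1
  rw [h.iterate hw t ht.le]
  congr 1
  omega

/-- A path above layer `i` whose ends lie in layer `i` and whose ends' ancestral lines merge after
exactly `t` steps closes to a cycle. -/
theorem IsParentMap.cycleGraph_isContained (h : IsParentMap G d p) {i l t : ℕ} (z : ℕ → V)
    (hl : 1 ≤ l) (hz : ∀ s, s < l → G.Adj (z s) (z (s + 1)))
    (hinj : ∀ a b, a ≤ l → b ≤ l → z a = z b → a = b)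
    (h0 : d (z 0) = i) (hend : d (z l) = i) (hge : ∀ s, s ≤ l → (i : ℕ∞) ≤ d (z s))
    (ht1 : 1 ≤ t) (hti : t ≤ i) (heq : p^[t] (z 0) = p^[t] (z l))
    (hne : p^[t - 1] (z 0) ≠ p^[t - 1] (z l)) :
    (SimpleGraph.cycleGraph (l + 2 * t)).IsContained G := by
  have hne' : ∀ j, j < t → p^[j] (z l) ≠ p^[j] (z 0) := by
    intro j hj he
    apply hne
    rw [show t - 1 = (t - 1 - j) + j by omega, Function.iterate_add_apply,
      Function.iterate_add_apply, he]
  -- The cycle runs along `z`, descends from `z l` to the common ancestor, and climbs back to `z 0`.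
  -- The path stays in layers at least `i`, the lines lie strictly below, and they are disjoint
  -- before step `t`.
  set g : ℕ → V := fun s => if s ≤ l then z s else
    if s ≤ l + t then p^[s - l] (z l) else p^[l + 2 * t - s] (z 0) with hg
  have gA : ∀ s, s ≤ l → g s = z s := fun s hs => by simp [hg, hs]
  have gB : ∀ s, l ≤ s → s ≤ l + t → g s = p^[s - l] (z l) := fun s hs hs' => by
    rcases hs.eq_or_lt with rfl | hlt
    · simp [hg]
    · simp [hg, hs', not_le.2 hlt]
  have gC : ∀ s, l + t ≤ s → s ≤ l + 2 * t → g s = p^[l + 2 * t - s] (z 0) := fun s hs hs' => by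
    rcases hs.eq_or_lt with rfl | hlt
    · rw [gB _ (by omega) le_rfl, show l + t - l = t by omega,
        show l + 2 * t - (l + t) = t by omega, heq]
    · simp only [hg]
      rw [if_neg (by omega), if_neg (by omega)]
  have dB : ∀ s, l ≤ s → s ≤ l + t → d (g s) = ((i - (s - l) : ℕ) : ℕ∞) := fun s hs hs' => by
    rw [gB s hs hs', h.iterate hend _ (by omega)]
  have dC : ∀ s, l + t ≤ s → s ≤ l + 2 * t → d (g s) = ((i - (l + 2 * t - s) : ℕ) : ℕ∞) :=
    fun s hs hs' => by rw [gC s hs hs', h.iterate h0 _ (by omega)]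
  have hlow : ∀ s, l < s → s < l + 2 * t → d (g s) < i := by
    intro s hs hs'
    by_cases hst : s ≤ l + t
    · rw [dB s hs.le hst]
      exact_mod_cast (by omega : i - (s - l) < i)
    · rw [dC s (by omega) hs'.le]
      exact_mod_cast (by omega : i - (l + 2 * t - s) < i)
  have hBC : ∀ a b, l < a → a ≤ l + t → l + t < b → b < l + 2 * t → g a ≠ g b := by
    intro a b ha ha' hb hb' he
    have hd := congrArg d he
    rw [dB a ha.le ha', dC b hb.le hb'.le] at hd
    have hd' := Nat.cast_injective (R := ℕ∞) hd
    rw [gB a ha.le ha', gC b hb.le hb'.le, show a - l = l + 2 * t - b by omega] at he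
    exact hne' _ (by omega) he
  have hsame : ∀ a b, a < b → b < l + 2 * t → g a ≠ g b := by
    intro a b hab hb he
    by_cases hal : a ≤ l
    · by_cases hbl : b ≤ l
      · rw [gA a hal, gA b hbl] at he
        have := hinj a b hal hbl he
        omega
      · have h1 := hlow b (by omega) hb
        rw [← he, gA a hal] at h1
        exact absurd (hge a hal) (not_le.2 h1)
    · by_cases hat : a ≤ l + t
      · by_cases hbt : b ≤ l + t
        · have hd := congrArg d he
          rw [dB a (by omega) hat, dB b (by omega) hbt] at hd
          have := Nat.cast_injective (R := ℕ∞) hd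
          omega
        · exact hBC a b (by omega) hat (by omega) hb he
      · have hd := congrArg d he
        rw [dC a (by omega) (by omega), dC b (by omega) hb.le] at hd
        have := Nat.cast_injective (R := ℕ∞) hd
        omega
  refine cycleGraph_isContained_of_injOn (by omega) g (fun a b ha hb he => ?_) (fun s hs => ?_) ?_
  · rcases lt_trichotomy a b with hab | hab | hab
    · exact absurd he (hsame a b hab hb)
    · exact hab
    · exact absurd he.symm (hsame b a hab ha)
  · by_cases hsl : s < l
    · rw [gA s hsl.le, gA (s + 1) hsl]
      exact hz s hsl
    · by_cases hst : s < l + t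
      · rw [gB s (by omega) hst.le, gB (s + 1) (by omega) hst, show s + 1 - l = (s - l) + 1 by omega]
        exact (h.adj_iterate hend (s - l) (by omega)).symm
      · rw [gC s (by omega) (by omega), gC (s + 1) (by omega) (by omega),
          show l + 2 * t - s = (l + 2 * t - (s + 1)) + 1 by omega]
        exact h.adj_iterate h0 _ (by omega)
  · rw [gC _ (by omega) (by omega), gA 0 (by omega),
      show l + 2 * t - (l + 2 * t - 1) = 0 + 1 by omega]
    exact h.adj_iterate h0 0 (by omega)

/-- A code of vertices by natural numbers that orders each layer compatibly with the order on the
parents. -/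
theorem exists_layer_code [Fintype V] (p : V → V) : ∃ c : ℕ → V → ℕ,
    (∀ j, Function.Injective (c j)) ∧
    ∀ j a b, c (j + 1) a ≤ c (j + 1) b → c j (p a) ≤ c j (p b) := by
  classical
  let e := Fintype.equivFin V
  set N := Fintype.card V with hN
  -- The code is lexicographic: the parent's code is the more significant part, and the vertex's own
  -- number the last digit in base `N`.
  let c : ℕ → V → ℕ := fun j => Nat.rec (fun w => (e w : ℕ)) (fun _ f w => f (p w) * N + e w) j
  have hc : ∀ j w, c (j + 1) w = c j (p w) * N + e w := fun _ _ => rfl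
  have hmod : ∀ j w, c j w % N = e w := by
    intro j w
    cases j with
    | zero => exact Nat.mod_eq_of_lt (e w).2
    | succ j => rw [hc, mul_comm, Nat.mul_add_mod, Nat.mod_eq_of_lt (e w).2]
  refine ⟨c, fun j a b hab => ?_, fun j a b hab => ?_⟩
  · apply e.injective
    apply Fin.ext
    rw [← hmod j a, ← hmod j b, hab]
  · rw [hc, hc] at hab
    refine le_of_not_gt fun hlt => ?_
    have h1 := (e b).2
    have h2 : (c j (p b) + 1) * N ≤ c j (p a) * N := Nat.mul_le_mul_right _ hlt
    rw [add_mul, one_mul] at h2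
    omega

/-- In a sequence of vertices of a layer that increases in the code, one can find at every index
gap `e` two vertices whose ancestral lines merge after exactly `t` steps, with `t` uniform. -/
theorem IsParentMap.exists_merge (h : IsParentMap G d p) {c : ℕ → V → ℕ}
    (hci : ∀ j, Function.Injective (c j))
    (hcm : ∀ j a b, c (j + 1) a ≤ c (j + 1) b → c j (p a) ≤ c j (p b))
    {i L : ℕ} (hL : 1 ≤ L) (w : ℕ → V) (hw : ∀ s, s ≤ L → d (w s) = i)
    (hinc : ∀ s, s < L → c i (w s) < c i (w (s + 1))) :
    ∃ t, 1 ≤ t ∧ t ≤ i ∧ ∀ e, 1 ≤ e → e ≤ L → ∃ s, s + e ≤ L ∧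
      p^[t] (w s) = p^[t] (w (s + e)) ∧ p^[t - 1] (w s) ≠ p^[t - 1] (w (s + e)) := by
  classical
  have hmono : ∀ t, t ≤ i → ∀ s, s < L → c (i - t) (p^[t] (w s)) ≤ c (i - t) (p^[t] (w (s + 1))) := by
    intro t
    induction t with
    | zero => exact fun _ s hs => (hinc s hs).le
    | succ t ih =>
      intro ht s hs
      rw [Function.iterate_succ_apply', Function.iterate_succ_apply']
      apply hcm
      rw [show i - (t + 1) + 1 = i - t by omega]
      exact ih (by omega) s hs
  have hmono' : ∀ t, t ≤ i → ∀ n s, s + n ≤ L →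
      c (i - t) (p^[t] (w s)) ≤ c (i - t) (p^[t] (w (s + n))) := by
    intro t ht n
    induction n with
    | zero => exact fun _ _ => le_rfl
    | succ n ih => exact fun s hs => (ih s (by omega)).trans (hmono t ht (s + n) (by omega))
  have hlt : ∀ n s, s + n + 1 ≤ L → c i (w s) < c i (w (s + n + 1)) := fun n s hs =>
    (hmono' 0 (by omega) n s (by omega)).trans_lt (hinc (s + n) (by omega))
  have hroot : p^[i] (w 0) = p^[i] (w L) := by
    refine h.root_unique _ _ ?_ ?_
    · rw [h.iterate (hw 0 (by omega)) i le_rfl]; simp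
    · rw [h.iterate (hw L le_rfl) i le_rfl]; simp
  have hex : ∃ t, p^[t] (w 0) = p^[t] (w L) := ⟨i, hroot⟩
  -- `t` is the first time at which the two end vertices merge; monotonicity of the codes then
  -- squeezes all intermediate vertices to the same ancestor.
  set t := Nat.find hex with ht
  have hspec : p^[t] (w 0) = p^[t] (w L) := Nat.find_spec hex
  have hti : t ≤ i := Nat.find_min' hex hroot
  have ht1 : 1 ≤ t := by
    by_contra h0
    have h0' : t = 0 := by omega
    rw [h0'] at hspec
    have := hlt (L - 1) 0 (by omega)
    rw [show 0 + (L - 1) + 1 = L by omega] at this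
    simp only [Function.iterate_zero, id] at hspec
    rw [hspec] at this
    exact lt_irrefl _ this
  have hmin : p^[t - 1] (w 0) ≠ p^[t - 1] (w L) := Nat.find_min hex (by omega)
  have hall : ∀ s, s ≤ L → p^[t] (w s) = p^[t] (w 0) := by
    intro s hs
    apply hci (i - t)
    apply le_antisymm
    · have := hmono' t hti (L - s) s (by omega)
      rwa [show s + (L - s) = L by omega, ← hspec] at this
    · have := hmono' t hti s 0 (by omega)
      rwa [zero_add] at this
  refine ⟨t, ht1, hti, fun e he heL => ?_⟩
  by_contra hcon
  push Not at hcon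
  have heq : ∀ s, s + e ≤ L → p^[t - 1] (w s) = p^[t - 1] (w (s + e)) := fun s hs =>
    hcon s hs ((hall s (by omega)).trans (hall (s + e) hs).symm)
  have hstep : ∀ s, s < L → p^[t - 1] (w s) = p^[t - 1] (w (s + 1)) := by
    intro s hs
    have hm := hmono' (t - 1) (by omega)
    -- The window from `s'` to `s' + e` contains `s` and `s + 1` and fits into `[0, L]`. If its ends
    -- agree at time `t - 1`, monotonicity makes everything inside agree.
    set s' := min s (L - e) with hs'
    have h1 := hm (s - s') s' (by omega)
    have h2 := hm 1 s (by omega)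
    have h3 := hm (s' + e - (s + 1)) (s + 1) (by omega)
    rw [show s' + (s - s') = s by omega] at h1
    rw [show s + 1 + (s' + e - (s + 1)) = s' + e by omega, ← heq s' (by omega)] at h3
    exact hci _ (le_antisymm h2 (h3.trans h1))
  have hconst : ∀ s, s ≤ L → p^[t - 1] (w 0) = p^[t - 1] (w s) := by
    intro s
    induction s with
    | zero => exact fun _ => rfl
    | succ s ih => exact fun hs => (ih (by omega)).trans (hstep s (by omega))
  exact hmin (hconst L le_rfl)

/-- A set without long paths that increase in an injective labelling has few colours. -/
theorem exists_coloring_of_no_increasing_path (S : Set V) (c : V → ℕ) (hc : Function.Injective c)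
    (L : ℕ) (hno : ∀ q : ℕ → V, (∀ s, s ≤ L → q s ∈ S) → (∀ s, s < L → G.Adj (q s) (q (s + 1))) →
      ¬ ∀ s, s < L → c (q s) < c (q (s + 1))) (hL : 1 ≤ L) :
    ∃ f : V → Fin L, ∀ a ∈ S, ∀ b ∈ S, G.Adj a b → f a ≠ f b := by
  classical
  -- `P w n` says that an increasing path of `n` edges in `S` ends at `w`. The colour of `w` is the
  -- largest such `n`, which increases strictly along every edge of `S`.
  let P : V → ℕ → Prop := fun w n => ∃ q : ℕ → V, q n = w ∧ (∀ s, s ≤ n → q s ∈ S) ∧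
    (∀ s, s < n → G.Adj (q s) (q (s + 1))) ∧ ∀ s, s < n → c (q s) < c (q (s + 1))
  have hP0 : ∀ w ∈ S, P w 0 := fun w hw => ⟨fun _ => w, rfl, fun _ _ => hw, by simp, by simp⟩
  have hPL : ∀ w, ¬ P w L := fun w ⟨q, _, h1, h2, h3⟩ => hno q h1 h2 h3
  have hPs : ∀ a b n, b ∈ S → G.Adj a b → c a < c b → P a n → P b (n + 1) := by
    rintro a b n hb hab hlt ⟨q, hq, h1, h2, h3⟩
    have e : ∀ s, s ≤ n → (if s ≤ n then q s else b) = q s := fun s hs => if_pos hs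
    refine ⟨fun s => if s ≤ n then q s else b, by simp, fun s hs => ?_, fun s hs => ?_, fun s hs => ?_⟩
    · dsimp only
      split_ifs with hsn
      · exact h1 s hsn
      · exact hb
    · dsimp only
      rw [e s (by omega)]
      split_ifs with hsn
      · exact h2 s hsn
      · rw [show s = n by omega, hq]; exact hab
    · dsimp only
      rw [e s (by omega)]
      split_ifs with hsn
      · exact h3 s hsn
      · rw [show s = n by omega, hq]; exact hlt
  have hlt : ∀ w, Nat.findGreatest (P w) L < L := by
    intro w
    refine lt_of_le_of_ne (Nat.findGreatest_le L) fun he => hPL w ?_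
    have := Nat.findGreatest_of_ne_zero (P := P w) he (by omega)
    exact this
  have hstep : ∀ a ∈ S, ∀ b ∈ S, G.Adj a b → c a < c b →
      Nat.findGreatest (P a) L < Nat.findGreatest (P b) L := by
    intro a ha b hb hab hc
    have h1 : P a (Nat.findGreatest (P a) L) :=
      Nat.findGreatest_spec (Nat.zero_le L) (hP0 a ha)
    exact Nat.le_findGreatest (hlt a) (hPs a b _ hb hab hc h1)
  refine ⟨fun w => ⟨_, hlt w⟩, fun a ha b hb hab he => ?_⟩
  rw [Fin.mk.injEq] at he
  rcases lt_trichotomy (c a) (c b) with h | h | h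
  · exact (hstep a ha b hb hab h).ne he
  · exact hab.ne (hc h)
  · exact (hstep b hb a ha hab.symm h).ne he.symm

/-- An increasing path of `r` edges within the layer would contain a stretch of `r - 2 * t` edges
whose ends merge after exactly `t` steps, closing to a cycle of length `r`. Since `t ≤ i`, the
condition `2 * i < r` makes the stretch nonempty. -/
theorem IsParentMap.exists_layer_coloring [Fintype V] (h : IsParentMap G d p) {r i : ℕ}
    (hr : 3 ≤ r) (hfree : (SimpleGraph.cycleGraph r).Free G) (hi : 2 * i < r) :
    ∃ f : V → Fin r, ∀ a b, d a = i → d b = i → G.Adj a b → f a ≠ f b := by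
  obtain ⟨c, hci, hcm⟩ := exists_layer_code p
  have hno : ∀ q : ℕ → V, (∀ s, s ≤ r → q s ∈ {w | d w = i}) →
      (∀ s, s < r → G.Adj (q s) (q (s + 1))) → ¬ ∀ s, s < r → c i (q s) < c i (q (s + 1)) := by
    intro q hq hadj hinc
    have hlt : ∀ n s, s + n + 1 ≤ r → c i (q s) < c i (q (s + n + 1)) := by
      intro n
      induction n with
      | zero => exact fun s hs => hinc s (by omega)
      | succ n ih => exact fun s hs => (ih s (by omega)).trans (hinc _ (by omega))
    have hinj : ∀ a b, a ≤ r → b ≤ r → q a = q b → a = b := by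
      intro a b ha hb he
      rcases lt_trichotomy a b with hab | hab | hab
      · have := hlt (b - a - 1) a (by omega)
        rw [show a + (b - a - 1) + 1 = b by omega, he] at this
        exact absurd this (lt_irrefl _)
      · exact hab
      · have := hlt (a - b - 1) b (by omega)
        rw [show b + (a - b - 1) + 1 = a by omega, he] at this
        exact absurd this (lt_irrefl _)
    obtain ⟨t, ht1, hti, ht⟩ := h.exists_merge hci hcm (by omega : 1 ≤ r) q hq hinc
    obtain ⟨s, hs, heq, hne⟩ := ht (r - 2 * t) (by omega) (by omega)
    refine hfree ?_
    have := h.cycleGraph_isContained (i := i) (l := r - 2 * t) (t := t) (fun a => q (s + a))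
      (by omega) (fun a ha => hadj _ (by omega))
      (fun a b ha hb he => by have := hinj _ _ (by omega) (by omega) he; omega)
      (hq _ (by omega)) (hq _ (by omega)) (fun a ha => (hq _ (by omega)).ge) ht1 hti heq hne
    rwa [show r - 2 * t + 2 * t = r by omega] at this
  obtain ⟨f, hf⟩ := exists_coloring_of_no_increasing_path {w | d w = i} (c i) (hci i) r hno
    (by omega)
  exact ⟨f, fun a b ha hb => hf a ha b hb⟩

end Cycles

/-! ### Orienting the edges between layers `i` and `i + 1` when `r = 2 * i + 2` -/

section EvenLayer

variable {V : Type*} [Fintype V] {G : SimpleGraph V} {d : V → ℕ∞} {p : V → V}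

/-- The pairs of `E` that survive `j` rounds; in a round, each right vertex deletes its pair with
the largest left vertex, and each left vertex with at most `K` pairs deletes all of them. -/
def survivingPairs (c : V → ℕ) (E : V → V → Prop) (K : ℕ) : ℕ → V → V → Prop
  | 0 => E
  | j + 1 => fun w u => survivingPairs c E K j w u ∧
      (∃ w', c w < c w' ∧ survivingPairs c E K j w' u) ∧
      K < {u' | survivingPairs c E K j w u'}.ncard

omit [Fintype V] in
theorem survivingPairs_subset (c : V → ℕ) (E : V → V → Prop) (K j : ℕ) {w u : V}
    (h : survivingPairs c E K j w u) : E w u := by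
  induction j with
  | zero => exact h
  | succ j ih => exact ih h.1

-- Each step of the zigzag uses two rounds: the outer one provides a larger left vertex `w'` for
-- `u`, the inner one more than `K` right vertices for `w'`, hence a fresh one. `F` holds the right
-- vertices already used.
omit [Fintype V] in
theorem exists_zigzag_of_survivingPairs (c : V → ℕ) (E : V → V → Prop) (K n : ℕ) :
    ∀ (w u : V) (F : Finset V), #F + n ≤ K → u ∉ F → survivingPairs c E K (2 * n) w u →
      ∃ a b : ℕ → V, a 0 = w ∧ b 0 = u ∧ (∀ s, s ≤ n → E (a s) (b s)) ∧
        (∀ s, s < n → E (a (s + 1)) (b s)) ∧ (∀ s, s < n → c (a s) < c (a (s + 1))) ∧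
        (∀ s t, s ≤ n → t ≤ n → b s = b t → s = t) ∧ ∀ s, s ≤ n → b s ∉ F := by
  classical
  induction n with
  | zero =>
    intro w u F _ hu h
    refine ⟨fun _ => w, fun _ => u, rfl, rfl, fun _ _ => h, by simp, by simp, ?_, fun _ _ => hu⟩
    intro s t hs ht _
    omega
  | succ n ih =>
    intro w u F hF hu h
    have hE := survivingPairs_subset c E K _ h
    obtain ⟨-, ⟨w', hc, hw'⟩, -⟩ := h
    have hw'E := survivingPairs_subset c E K _ hw'
    obtain ⟨-, -, hcard⟩ := hw'
    have hFu : #(insert u F) ≤ K := (card_insert_le _ _).trans (by omega)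
    obtain ⟨u', hu', hu'F⟩ : ∃ u' ∈ {u' | survivingPairs c E K (2 * n) w' u'},
        u' ∉ (↑(insert u F) : Set V) := by
      refine Set.exists_mem_notMem_of_ncard_lt_ncard ?_ (Finset.finite_toSet _)
      rw [Set.ncard_coe_finset]
      exact lt_of_le_of_lt hFu hcard
    obtain ⟨a, b, ha, hb, h1, h2, h3, h4, h5⟩ := ih w' u' (insert u F)
      ((Nat.add_le_add_right (card_insert_le _ _) n).trans (by omega))
      (by simpa using hu'F) hu'
    refine ⟨fun s => Nat.casesOn s w a, fun s => Nat.casesOn s u b, rfl, rfl, ?_, ?_, ?_, ?_, ?_⟩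
    · rintro (_ | s) hs
      · exact hE
      · exact h1 s (by omega)
    · rintro (_ | s) hs
      · change E (a 0) u; rw [ha]; exact hw'E
      · exact h2 s (by omega)
    · rintro (_ | s) hs
      · change c w < c (a 0); rw [ha]; exact hc
      · exact h3 s (by omega)
    · have hne : ∀ t, t ≤ n → u ≠ b t := fun t ht he => h5 t ht (he ▸ mem_insert_self _ _)
      rintro (_ | s) (_ | t) hs ht he
      · rfl
      · exact absurd he (hne t (by omega))
      · exact absurd he.symm (hne s (by omega))
      · rw [h4 s t (by omega) (by omega) he]
    · rintro (_ | s) hs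
      · exact hu
      · exact fun hmem => h5 s (by omega) (mem_insert_of_mem hmem)

omit [Fintype V] in
/-- In a graph without a cycle of length `2 * i + 2`, no pairs between layers `i` and `i + 1`
survive. -/
theorem IsParentMap.not_survivingPairs (h : IsParentMap G d p) {i : ℕ} (hi : 1 ≤ i)
    (hfree : (SimpleGraph.cycleGraph (2 * i + 2)).Free G) {c : ℕ → V → ℕ}
    (hci : ∀ j, Function.Injective (c j))
    (hcm : ∀ j a b, c (j + 1) a ≤ c (j + 1) b → c j (p a) ≤ c j (p b)) (w u : V) :
    ¬ survivingPairs (c i) (fun w u => d w = i ∧ d u = ((i + 1 : ℕ) : ℕ∞) ∧ G.Adj w u) i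
      (2 * i) w u := by
  intro hs
  obtain ⟨a, b, -, -, h1, h2, h3, h4, -⟩ := exists_zigzag_of_survivingPairs _ _ _ _ w u ∅
    (by simp) (by simp) hs
  have hlt : ∀ n s, s + n + 1 ≤ i → c i (a s) < c i (a (s + n + 1)) := by
    intro n
    induction n with
    | zero => exact fun s hs => h3 s (by omega)
    | succ n ih => exact fun s hs => (ih s (by omega)).trans (h3 _ (by omega))
  have hainj : ∀ s t, s ≤ i → t ≤ i → a s = a t → s = t := by
    intro s t hs ht he
    rcases lt_trichotomy s t with hst | hst | hst
    · have := hlt (t - s - 1) s (by omega)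
      rw [show s + (t - s - 1) + 1 = t by omega, he] at this
      exact absurd this (lt_irrefl _)
    · exact hst
    · have := hlt (s - t - 1) t (by omega)
      rw [show t + (s - t - 1) + 1 = s by omega, he] at this
      exact absurd this (lt_irrefl _)
  have hab : ∀ s t, s ≤ i → t ≤ i → a s ≠ b t := by
    intro s t hs ht he
    have e1 := (h1 s hs).1
    rw [he, (h1 t ht).2.1] at e1
    have := Nat.cast_injective (R := ℕ∞) e1
    omega
  obtain ⟨t, ht1, hti, ht⟩ := h.exists_merge hci hcm hi a (fun s hs => (h1 s hs).1) h3
  -- A zigzag across the gap `i + 1 - t` has `2 * (i + 1 - t)` edges; the two ancestral lines add `2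
  -- * t`, for a total of `2 * i + 2`.
  obtain ⟨s, hs, heq, hne⟩ := ht (i + 1 - t) (by omega) (by omega)
  set e := i + 1 - t with he
  set z : ℕ → V := fun q => if q % 2 = 0 then a (s + q / 2) else b (s + q / 2) with hz
  have z0 : z 0 = a s := by simp [hz]
  have zl : z (2 * e) = a (s + e) := by simp [hz]
  refine hfree ?_
  have := h.cycleGraph_isContained (i := i) (l := 2 * e) (t := t) z (by omega) (fun q hq => ?_)
    (fun q q' hq hq' heq => ?_) (by rw [z0]; exact (h1 _ (by omega)).1)
    (by rw [zl]; exact (h1 _ hs).1) (fun q hq => ?_) ht1 hti (by rw [z0, zl, heq])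
    (by rw [z0, zl]; exact hne)
  · rwa [show 2 * e + 2 * t = 2 * i + 2 by omega] at this
  · simp only [hz]
    by_cases hq2 : q % 2 = 0
    · rw [if_pos hq2, if_neg (by omega), show (q + 1) / 2 = q / 2 by omega]
      exact (h1 _ (by omega)).2.2
    · rw [if_neg hq2, if_pos (by omega), show s + (q + 1) / 2 = s + q / 2 + 1 by omega]
      exact (h2 _ (by omega)).2.2.symm
  · simp only [hz] at heq
    split_ifs at heq
    · have := hainj _ _ (by omega) (by omega) heq; omega
    · exact absurd heq (hab _ _ (by omega) (by omega))
    · exact absurd heq.symm (hab _ _ (by omega) (by omega))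
    · have := h4 _ _ (by omega) (by omega) heq; omega
  · simp only [hz]
    split_ifs
    · exact (h1 _ (by omega)).1.ge
    · rw [(h1 _ (by omega)).2.1]
      exact_mod_cast Nat.le_succ i

/-- In a graph without a cycle of length `2 * i + 2`, the edges between layers `i` and `i + 1` can
be oriented with bounded out-degree. -/
theorem IsParentMap.exists_orientation (h : IsParentMap G d p) {i : ℕ} (hi : 1 ≤ i)
    (hfree : (SimpleGraph.cycleGraph (2 * i + 2)).Free G) :
    ∃ o : V → V → Prop, (∀ a b, o a b → G.Adj a b) ∧
      (∀ w u, d w = i → d u = ((i + 1 : ℕ) : ℕ∞) → G.Adj w u → o w u ∨ o u w) ∧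
      ∀ a, {b | o a b}.ncard ≤ 2 * i * (i + 1) := by
  classical
  obtain ⟨c, hci, hcm⟩ := exists_layer_code p
  set E : V → V → Prop := fun w u => d w = i ∧ d u = ((i + 1 : ℕ) : ℕ∞) ∧ G.Adj w u
  set P := survivingPairs (c i) E i with hP
  -- An edge is oriented away from an end that deletes it. In round `j`, `A j x` has the at most `i`
  -- pairs dropped by a left vertex `x`, and `B j x` the single pair dropped by a right vertex `x`,
  -- so each of the `2 * i` rounds contributes at most `i + 1`.
  let A : ℕ → V → Set V := fun j x => {y | P j x y ∧ {u | P j x u}.ncard ≤ i}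
  let B : ℕ → V → Set V := fun j x => {y | P j y x ∧ ∀ w, P j w x → c i w ≤ c i y}
  have hA : ∀ j x, (A j x).ncard ≤ i := by
    intro j x
    by_cases hx : {u | P j x u}.ncard ≤ i
    · exact (Set.ncard_le_ncard (fun y hy => hy.1)).trans hx
    · have : A j x = ∅ := Set.eq_empty_of_forall_notMem fun y hy => hx hy.2
      rw [this]; simp
  have hB : ∀ j x, (B j x).ncard ≤ 1 := by
    intro j x
    rw [Set.ncard_le_one]
    exact fun y hy z hz => hci i (le_antisymm (hz.2 y hy.1) (hy.2 z hz.1))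
  refine ⟨fun x y => ∃ j < 2 * i, y ∈ A j x ∪ B j x, ?_, ?_, ?_⟩
  · rintro x y ⟨j, -, hy | hy⟩
    · exact (survivingPairs_subset _ _ _ _ hy.1).2.2
    · exact (survivingPairs_subset _ _ _ _ hy.1).2.2.symm
  · intro w u hw hu hadj
    have hno := h.not_survivingPairs hi hfree hci hcm w u
    have hex : ∃ j, ¬ P j w u := ⟨2 * i, hno⟩
    have h0 : P 0 w u := ⟨hw, hu, hadj⟩
    obtain ⟨j, hj⟩ : ∃ j, Nat.find hex = j + 1 := by
      refine Nat.exists_eq_succ_of_ne_zero fun he => ?_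
      have := Nat.find_spec hex
      rw [he] at this
      exact this h0
    have hj1 : ¬ P (j + 1) w u := hj ▸ Nat.find_spec hex
    have hj0 : P j w u := not_not.1 (Nat.find_min hex (by omega))
    have hj2 : j < 2 * i := by have := Nat.find_min' hex hno; omega
    by_cases hmax : ∃ w', c i w < c i w' ∧ P j w' u
    · left
      refine ⟨j, hj2, Or.inl ⟨hj0, ?_⟩⟩
      by_contra hlt
      exact hj1 ⟨hj0, hmax, not_le.1 hlt⟩
    · right
      refine ⟨j, hj2, Or.inr ⟨hj0, fun w' hw' => ?_⟩⟩
      by_contra hlt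
      exact hmax ⟨w', not_le.1 hlt, hw'⟩
  · intro x
    have hsub : {y | ∃ j < 2 * i, y ∈ A j x ∪ B j x} ⊆
        ↑((range (2 * i)).biUnion fun j => (A j x ∪ B j x).toFinset) := by
      rintro y ⟨j, hj, hy⟩
      simp only [coe_biUnion, Set.mem_iUnion, coe_range, Set.mem_Iio, Set.coe_toFinset]
      exact ⟨j, hj, hy⟩
    refine (Set.ncard_le_ncard hsub (Finset.finite_toSet _)).trans ?_
    rw [Set.ncard_coe_finset]
    refine (card_biUnion_le_card_mul _ _ (i + 1) fun j _ => ?_).trans_eq (by rw [card_range])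
    rw [← Set.ncard_eq_toFinset_card']
    exact (Set.ncard_union_le _ _).trans (Nat.add_le_add (hA j x) (hB j x))

end EvenLayer

/-! ### Growth of eigenvectors over distance layers -/

section Growth

variable {V E : Type*} [Fintype V] [NormedAddCommGroup E] [InnerProductSpace ℝ E]
  {G : SimpleGraph V} {u : V → E}

omit [Fintype V] in
theorem IsOrthRep.inner_sum_le_of_colorings (hu : IsOrthRep G u) (S T : Finset V) {K : ℕ}
    (hS : ∃ f : V → Fin K, ∀ a ∈ S, ∀ b ∈ S, G.Adj a b → f a ≠ f b)
    (hT : ∃ f : V → Fin K, ∀ a ∈ T, ∀ b ∈ T, G.Adj a b → f a ≠ f b) (x : V → ℝ) :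
    inner ℝ (∑ v ∈ S, x v • u v) (∑ v ∈ T, x v • u v) ≤
      K * (√(∑ a ∈ S, x a ^ 2) * √(∑ b ∈ T, x b ^ 2)) := by
  obtain ⟨f, hf⟩ := hS
  obtain ⟨g, hg⟩ := hT
  have h1 := Real.le_sqrt_of_sq_le (hu.norm_sum_sq_le_of_coloring S f hf x)
  have h2 := Real.le_sqrt_of_sq_le (hu.norm_sum_sq_le_of_coloring T g hg x)
  refine (real_inner_le_norm _ _).trans ((mul_le_mul h1 h2 (norm_nonneg _) (Real.sqrt_nonneg _)).trans_eq ?_)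
  rw [Real.sqrt_mul (by positivity), Real.sqrt_mul (by positivity)]
  have : √(K : ℝ) * √(K : ℝ) = K := Real.mul_self_sqrt (by positivity)
  linear_combination (√(∑ a ∈ S, x a ^ 2) * √(∑ b ∈ T, x b ^ 2)) * this

theorem IsOrthRep.inner_sum_le_of_orientation (hu : IsOrthRep G u) {K D : ℕ}
    (hK : LocallyColorable G K) (S T : Finset V) (hST : Disjoint S T) (o : V → V → Prop)
    (hadj : ∀ a b, o a b → G.Adj a b)
    (ho : ∀ a ∈ S, ∀ b ∈ T, G.Adj a b → o a b ∨ o b a) (hD : ∀ a, {b | o a b}.ncard ≤ D)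
    (x : V → ℝ) :
    inner ℝ (∑ v ∈ S, x v • u v) (∑ v ∈ T, x v • u v) ≤
      2 * √(K * D) * (√(∑ a ∈ S, x a ^ 2) * √(∑ b ∈ T, x b ^ 2)) := by
  classical
  have hD' : ∀ (T : Finset V) a, #{b ∈ T | o a b} ≤ D := fun T a => by
    refine le_trans ?_ (hD a)
    rw [← Set.ncard_coe_finset]
    exact Set.ncard_le_ncard fun b hb => (mem_filter.1 hb).2
  have h1 := hu.oriented_sum_le hK o hadj S T (fun a _ => hD' T a) x
  have h2 := hu.oriented_sum_le hK o hadj T S (fun a _ => hD' S a) x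
  have e : inner ℝ (∑ v ∈ S, x v • u v) (∑ v ∈ T, x v • u v) =
      ∑ a ∈ S, ∑ b ∈ T, inner ℝ (u a) (u b) * x a * x b := by
    rw [sum_inner]
    refine sum_congr rfl fun a _ => ?_
    rw [inner_sum]
    refine sum_congr rfl fun b _ => ?_
    rw [inner_smul_left, inner_smul_right, conj_trivial]
    ring
  have h3 : ∑ a ∈ S, ∑ b ∈ T, inner ℝ (u a) (u b) * x a * x b ≤
      ∑ a ∈ S, ∑ b ∈ T with o a b, |inner ℝ (u a) (u b) * x a * x b| +
      ∑ b ∈ T, ∑ a ∈ S with o b a, |inner ℝ (u b) (u a) * x b * x a| := by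
    simp only [sum_filter]
    rw [sum_comm (s := T), ← sum_add_distrib]
    refine sum_le_sum fun a ha => ?_
    rw [← sum_add_distrib]
    refine sum_le_sum fun b hb => ?_
    have hsymm : |inner ℝ (u b) (u a) * x b * x a| = |inner ℝ (u a) (u b) * x a * x b| := by
      rw [real_inner_comm]; congr 1; ring
    rw [hsymm]
    by_cases hab : G.Adj a b
    · rcases ho a ha b hb hab with h | h
      · rw [if_pos h]
        split_ifs
        · linarith [le_abs_self (inner ℝ (u a) (u b) * x a * x b),
            abs_nonneg (inner ℝ (u a) (u b) * x a * x b)]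
        · linarith [le_abs_self (inner ℝ (u a) (u b) * x a * x b)]
      · rw [if_pos h]
        split_ifs
        · linarith [le_abs_self (inner ℝ (u a) (u b) * x a * x b),
            abs_nonneg (inner ℝ (u a) (u b) * x a * x b)]
        · linarith [le_abs_self (inner ℝ (u a) (u b) * x a * x b)]
    · have hne : a ≠ b := fun he => (Finset.disjoint_left.1 hST) ha (he ▸ hb)
      rw [hu.inner_eq_zero a b hne hab]
      simp
  rw [e]
  linarith

/-- As `l ≥ 3 * B` and `a 0 = 0`, the sequence cannot decrease while the recursion holds. The two
earlier terms are therefore absorbed, and each step gains a factor `l / (3 * B)`. -/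
theorem growth_of_three_term (a : ℕ → ℝ) (B l : ℝ) (k : ℕ) (hB : 0 < B) (hl : 3 * B ≤ l)
    (ha : ∀ i, 0 ≤ a i) (h0 : a 0 = 0)
    (h : ∀ i, i < k → l * a (i + 1) ≤ B * (a i + a (i + 1) + a (i + 2))) :
    a 1 * (l / (3 * B)) ^ k ≤ a (k + 1) := by
  have hstep : ∀ i, i < k → l * a (i + 1) ≤ 3 * B * a (i + 2) := by
    intro i
    induction i with
    | zero =>
      intro hi
      have h1 := h 0 hi
      rw [h0] at h1
      simp only [zero_add] at h1 ⊢
      nlinarith [mul_le_mul_of_nonneg_right hl (ha 1), mul_nonneg hB.le (ha 2)]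
    | succ i ih =>
      intro hi
      have h1 := h (i + 1) hi
      have h2 := ih (by omega)
      have h3 : a (i + 1) ≤ a (i + 2) := by
        have h4 := mul_le_mul_of_nonneg_right hl (ha (i + 1))
        have h5 : 3 * B * a (i + 1) ≤ 3 * B * a (i + 2) := h4.trans h2
        exact le_of_mul_le_mul_left h5 (by positivity)
      have h4 := mul_le_mul_of_nonneg_left h3 hB.le
      have h5 := mul_le_mul_of_nonneg_right hl (ha (i + 2))
      simp only [show i + 1 + 1 = i + 2 from rfl, show i + 1 + 2 = i + 3 from rfl] at h1 ⊢
      linarith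
  have hgen : ∀ j, j ≤ k → a 1 * (l / (3 * B)) ^ j ≤ a (j + 1) := by
    intro j
    induction j with
    | zero => intro _; simp
    | succ j ih =>
      intro hj
      have h1 := ih (by omega)
      have h2 := hstep j (by omega)
      have hq : 0 ≤ l / (3 * B) := by
        have : 0 < l := by linarith
        positivity
      calc a 1 * (l / (3 * B)) ^ (j + 1) = (a 1 * (l / (3 * B)) ^ j) * (l / (3 * B)) := by ring
        _ ≤ a (j + 1) * (l / (3 * B)) := mul_le_mul_of_nonneg_right h1 hq
        _ = (l * a (j + 1)) / (3 * B) := by ring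
        _ ≤ a (j + 2) := by rw [div_le_iff₀ (by positivity)]; linarith
  exact hgen k le_rfl

theorem exists_layer_coloring_of_cycle_free {r i : ℕ} (hr : 3 ≤ r)
    (hfree : (SimpleGraph.cycleGraph r).Free G) (hi : 2 * i < r) (v : V) :
    ∃ f : V → Fin r, ∀ a b, G.edist v a = i → G.edist v b = i → G.Adj a b → f a ≠ f b := by
  obtain ⟨p, hp⟩ := exists_isParentMap G v
  exact hp.exists_layer_coloring hr hfree hi

theorem locallyColorable_of_cycle_free {r : ℕ} (hr : 3 ≤ r)
    (hfree : (SimpleGraph.cycleGraph r).Free G) : LocallyColorable G r := by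
  intro v
  obtain ⟨f, hf⟩ := exists_layer_coloring_of_cycle_free (i := 1) hr hfree (by omega) v
  refine ⟨f, fun a b ha hb hab => hf a b ?_ ?_ hab⟩
  · simpa using ha
  · simpa using hb

/-- The entries of an eigenvector of the Gram matrix of an orthonormal representation of a graph
without cycles of length `r` are small compared with its norm. -/
theorem IsOrthRep.eigenvalue_pow_mul_sq_le (hu : IsOrthRep G u) {r : ℕ} (hr : 3 ≤ r)
    (hfree : (SimpleGraph.cycleGraph r).Free G) {x : V → ℝ} {l : ℝ} (hl : 0 ≤ l)
    (heig : ∀ v, inner ℝ (u v) (∑ w, x w • u w) = l * x v) (v : V) :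
    l ^ r * x v ^ 2 ≤ (6 * r ^ 2 : ℝ) ^ r * ∑ w, x w ^ 2 := by
  classical
  have hloc := locallyColorable_of_cycle_free hr hfree
  have hr3 : (3 : ℝ) ≤ r := by exact_mod_cast hr
  set B : ℝ := 2 * r ^ 2 with hB
  have hBpos : 0 < B := by positivity
  have hBr : (r : ℝ) ≤ B := by nlinarith
  have hsum : ∀ S : Finset V, 0 ≤ ∑ w ∈ S, x w ^ 2 := fun S => sum_nonneg fun _ _ => sq_nonneg _
  have hle : ∀ S : Finset V, ∑ w ∈ S, x w ^ 2 ≤ ∑ w, x w ^ 2 := fun S =>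
    sum_le_sum_of_subset_of_nonneg (subset_univ S) fun _ _ _ => sq_nonneg _
  have hxv : x v ^ 2 ≤ ∑ w, x w ^ 2 := by simpa using hle {v}
  rw [show (6 * r ^ 2 : ℝ) = 3 * B by rw [hB]; ring]
  rcases lt_or_ge l (3 * B) with hlt | hge
  · exact mul_le_mul (pow_le_pow_left₀ hl hlt.le r) hxv (sq_nonneg _) (by positivity)
  have hlpos : 0 < l := by linarith
  -- The shift by one makes `N 0` empty and `N (i + 1)` the layer at distance `i`, so the recursion
  -- starts from zero. Vertices in other components lie in no `N j`.
  let N : ℕ → Finset V := fun j => {w | G.edist v w + 1 = j}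
  have hN0 : N 0 = ∅ := by
    ext w
    simp [N]
  have hN : ∀ j w, w ∈ N (j + 1) ↔ G.edist v w = j := fun j w => by
    simp only [N, mem_filter, mem_univ, true_and, Nat.cast_add, Nat.cast_one]
    exact (ENat.add_left_injective_of_ne_top ENat.one_ne_top).eq_iff
  have hNd : ∀ i j, i ≠ j → Disjoint (N i) (N j) := by
    intro i j hij
    rw [Finset.disjoint_left]
    intro w hi hj
    simp only [N, mem_filter, mem_univ, true_and] at hi hj
    exact hij (Nat.cast_injective (R := ℕ∞) (hi.symm.trans hj))
  have hcol : ∀ i, 2 * i < r + 2 →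
      ∃ f : V → Fin r, ∀ a ∈ N i, ∀ b ∈ N i, G.Adj a b → f a ≠ f b := by
    rintro (_ | i) hi
    · exact ⟨fun _ => ⟨0, by omega⟩, by simp [hN0]⟩
    · obtain ⟨f, hf⟩ := exists_layer_coloring_of_cycle_free (i := i) hr hfree (by omega) v
      exact ⟨f, fun a ha b hb => hf a b ((hN i a).1 ha) ((hN i b).1 hb)⟩
  set a : ℕ → ℝ := fun i => √(∑ w ∈ N i, x w ^ 2) with ha
  have hasq : ∀ i, a i ^ 2 = ∑ w ∈ N i, x w ^ 2 := fun i => Real.sq_sqrt (hsum _)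
  have ha0 : ∀ i, 0 ≤ a i := fun i => Real.sqrt_nonneg _
  set s : ℕ → E := fun i => ∑ w ∈ N i, x w • u w with hs
  have hblock : ∀ i j, 2 * i < r + 2 → 2 * j < r + 2 → inner ℝ (s i) (s j) ≤ B * (a i * a j) := by
    intro i j hi hj
    refine (hu.inner_sum_le_of_colorings _ _ (hcol i hi) (hcol j hj) x).trans ?_
    exact mul_le_mul_of_nonneg_right hBr (mul_nonneg (ha0 i) (ha0 j))
  have hblock' : ∀ i, 2 * (i + 1) ≤ r → inner ℝ (s (i + 1)) (s (i + 2)) ≤ B * (a (i + 1) * a (i + 2)) := by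
    intro i hi
    by_cases hlt : 2 * (i + 2) < r + 2
    · exact hblock _ _ (by omega) hlt
    -- For even `r` the layer at distance `r / 2` is out of reach of the colouring lemma. The edges
    -- into it are oriented instead, with out-degrees at most `r ^ 3`, and `2 * √(r * r ^ 3) = B`.
    · have hr2 : r = 2 * i + 2 := by omega
      obtain ⟨p, hp⟩ := exists_isParentMap G v
      obtain ⟨o, ho1, ho2, ho3⟩ := hp.exists_orientation (i := i) (by omega) (hr2 ▸ hfree)
      refine (hu.inner_sum_le_of_orientation hloc (N (i + 1)) (N (i + 2)) (hNd _ _ (by omega)) o ho1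
        (fun w hw w' hw' => ho2 w w' ((hN i w).1 hw) ((hN (i + 1) w').1 hw')) (D := r ^ 3)
        (fun w => (ho3 w).trans ?_) x).trans ?_
      · rw [hr2]; nlinarith [Nat.zero_le i, Nat.zero_le (i ^ 3), Nat.zero_le (i ^ 2)]
      · refine mul_le_mul_of_nonneg_right ?_ (mul_nonneg (ha0 _) (ha0 _))
        have : √((r : ℝ) * ((r ^ 3 : ℕ) : ℝ)) = r ^ 2 := by
          rw [show (r : ℝ) * ((r ^ 3 : ℕ) : ℝ) = (r ^ 2) ^ 2 by push_cast; ring]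
          exact Real.sqrt_sq (by positivity)
        rw [this]
  -- The eigenvalue equation is paired with the part of `x` on one layer; orthogonality leaves only
  -- that layer and its two neighbours.
  have hthree : ∀ i, l * a (i + 1) ^ 2 =
      inner ℝ (s (i + 1)) (s i) + inner ℝ (s (i + 1)) (s (i + 1)) +
        inner ℝ (s (i + 1)) (s (i + 2)) := by
    intro i
    have e1 : l * a (i + 1) ^ 2 = inner ℝ (s (i + 1)) (∑ w, x w • u w) := by
      rw [hasq, hs]
      simp only [sum_inner, inner_smul_left, heig, conj_trivial, mul_sum]
      exact sum_congr rfl fun w _ => by ring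
    have e2 : inner ℝ (s (i + 1)) (∑ w, x w • u w) =
        inner ℝ (s (i + 1)) (∑ w ∈ N i ∪ N (i + 1) ∪ N (i + 2), x w • u w) := by
      simp only [inner_sum]
      symm
      refine sum_subset (subset_univ _) fun w _ hw => ?_
      rw [hs]
      simp only [sum_inner]
      refine sum_eq_zero fun b hb => ?_
      rw [inner_smul_left, inner_smul_right, hu.inner_eq_zero b w]
      · simp
      · rintro rfl
        exact hw (mem_union_left _ (mem_union_right _ hb))
      · intro hadj
        apply hw
        have hb' := (hN i b).1 hb
        have t1 := SimpleGraph.edist_triangle (G := G) (u := v) (v := b) (w := w)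
        have t2 := SimpleGraph.edist_triangle (G := G) (u := v) (v := w) (w := b)
        rw [SimpleGraph.edist_eq_one_iff_adj.2 hadj, hb'] at t1
        rw [SimpleGraph.edist_eq_one_iff_adj.2 hadj.symm, hb'] at t2
        obtain ⟨n, hn⟩ := ENat.ne_top_iff_exists.1 (ne_top_of_le_ne_top (by simp) t1)
        rw [← hn] at t1 t2
        have t1' : n ≤ i + 1 := by exact_mod_cast t1
        have t2' : i ≤ n + 1 := by exact_mod_cast t2
        have hw' : w ∈ N (n + 1) := (hN n w).2 hn.symm
        rcases (by omega : n + 1 = i ∨ n = i ∨ n = i + 1) with h | h | h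
        · rw [h] at hw'; exact mem_union_left _ (mem_union_left _ hw')
        · rw [h] at hw'; exact mem_union_left _ (mem_union_right _ hw')
        · rw [h] at hw'; exact mem_union_right _ hw'
    rw [e1, e2, sum_union, sum_union (hNd _ _ (by omega)), inner_add_right, inner_add_right]
    rw [disjoint_union_left]
    exact ⟨hNd _ _ (by omega), hNd _ _ (by omega)⟩
  have hgrow := growth_of_three_term a B l (r / 2) hBpos hge ha0
    (by simp [ha, hN0]) (fun i hi => by
      rcases (ha0 (i + 1)).eq_or_lt with h0 | hpos
      · rw [← h0, mul_zero]
        have := ha0 i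
        have := ha0 (i + 2)
        positivity
      · have h1 := hthree i
        have h2 := hblock (i + 1) i (by omega) (by omega)
        have h3 := hblock (i + 1) (i + 1) (by omega) (by omega)
        have h4 := hblock' i (by omega)
        refine le_of_mul_le_mul_left (a := a (i + 1)) ?_ hpos
        nlinarith)
  have hN1 : N 1 = {v} := by
    ext w
    rw [hN 0 w, mem_singleton, Nat.cast_zero, SimpleGraph.edist_eq_zero_iff, eq_comm]
  have ha1 : a 1 ^ 2 = x v ^ 2 := by rw [hasq, hN1, sum_singleton]
  set k := r / 2 with hk
  set q := l / (3 * B) with hq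
  have hq0 : 0 < q := by positivity
  have hsq : x v ^ 2 * q ^ (2 * k) ≤ ∑ w ∈ N (k + 1), x w ^ 2 := by
    have := pow_le_pow_left₀ (mul_nonneg (ha0 1) (by positivity)) hgrow 2
    rw [hasq, mul_pow, ha1, ← pow_mul, mul_comm k 2] at this
    exact this
  have hmain : x v ^ 2 * q ^ r ≤ ∑ w, x w ^ 2 := by
    rcases Nat.even_or_odd' r with ⟨k', hk' | hk'⟩
    · rw [show r = 2 * k by omega]
      exact hsq.trans (hle _)
    -- For odd `r` the growth gives only `r - 1` factors of `q`. The last one comes from Bessel on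
    -- the layer at distance `k`: `l ^ 2 * ∑ x w ^ 2` over that layer is at most `r * ‖z‖ ^ 2 = r *
    -- l * ∑ x w ^ 2`.
    · have hkk : r = 2 * k + 1 := by omega
      obtain ⟨f, hf⟩ := hcol (k + 1) (by omega)
      set z := ∑ w, x w • u w with hz
      have h1 := hu.sum_inner_sq_le_of_coloring (N (k + 1)) f hf z
      have h2 : ‖z‖ ^ 2 = l * ∑ w, x w ^ 2 := by
        rw [← real_inner_self_eq_norm_sq]
        nth_rw 1 [hz]
        simp only [sum_inner, inner_smul_left, heig, conj_trivial, mul_sum]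
        exact sum_congr rfl fun w _ => by ring
      simp only [heig, mul_pow, ← mul_sum] at h1
      rw [h2] at h1
      have h3 : l * ∑ w ∈ N (k + 1), x w ^ 2 ≤ r * ∑ w, x w ^ 2 := by
        refine le_of_mul_le_mul_left (a := l) ?_ hlpos
        linarith
      have h4 : q * ∑ w ∈ N (k + 1), x w ^ 2 ≤ ∑ w, x w ^ 2 := by
        rw [hq, div_mul_eq_mul_div, div_le_iff₀ (by positivity)]
        refine h3.trans ?_
        rw [mul_comm]
        exact mul_le_mul_of_nonneg_left (by linarith) (hsum _)
      calc x v ^ 2 * q ^ r = q * (x v ^ 2 * q ^ (2 * k)) := by rw [hkk]; ring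
        _ ≤ q * ∑ w ∈ N (k + 1), x w ^ 2 := mul_le_mul_of_nonneg_left hsq hq0.le
        _ ≤ _ := h4
  have hfin : l ^ r = (3 * B) ^ r * q ^ r := by
    rw [← mul_pow, hq]
    congr 1
    field_simp
  rw [hfin, mul_assoc, mul_comm (q ^ r)]
  exact mul_le_mul_of_nonneg_left hmain (by positivity)

end Growth

/-! ### The `D`-core and the bound for cycles -/

section Core

variable {V : Type*} [Fintype V] {G : SimpleGraph V}

/-- The `D`-core `T` of a graph, and an orientation of the edges outside `T` with out-degrees at
most `D`. -/
theorem exists_core (G : SimpleGraph V) [DecidableRel G.Adj] (D : ℕ) :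
    ∃ (T : Finset V) (o : V → V → Prop), (∀ v ∈ T, D ≤ #{w ∈ T | G.Adj v w}) ∧
      (∀ a b, o a b → G.Adj a b) ∧ (∀ a b, a ∉ T → b ∉ T → G.Adj a b → o a b ∨ o b a) ∧
      ∀ a, {b | o a b}.ncard ≤ D := by
  classical
  suffices h : ∀ U : Finset V, ∃ (T : Finset V) (o : V → V → Prop),
      (∀ v ∈ T, D ≤ #{w ∈ T | G.Adj v w}) ∧ (∀ a b, o a b → G.Adj a b ∧ a ∈ U) ∧
      (∀ a ∈ U, ∀ b ∈ U, a ∉ T → b ∉ T → G.Adj a b → o a b ∨ o b a) ∧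
      ∀ a, {b | o a b}.ncard ≤ D by
    obtain ⟨T, o, h1, h2, h3, h4⟩ := h univ
    exact ⟨T, o, h1, fun a b hab => (h2 a b hab).1,
      fun a b => h3 a (mem_univ a) b (mem_univ b), h4⟩
  intro U
  induction U using Finset.strongInduction with
  | H U ih =>
    by_cases hU : ∀ v ∈ U, D ≤ #{w ∈ U | G.Adj v w}
    · exact ⟨U, fun _ _ => False, hU, by simp, fun a ha _ _ hna => absurd ha hna, by simp⟩
    · push Not at hU
      obtain ⟨v, hv, hlt⟩ := hU
      obtain ⟨T, o, h1, h2, h3, h4⟩ := ih (U.erase v) (erase_ssubset hv)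
      -- All edges from `v` into `U` point away from `v`, fewer than `D` in number. Every other arc
      -- starts in `U.erase v`, so the out-degree of `v` does not grow.
      refine ⟨T, fun a b => o a b ∨ (a = v ∧ b ∈ U ∧ G.Adj v b), h1, ?_, ?_, ?_⟩
      · rintro a b (hab | ⟨rfl, -, hab⟩)
        · exact ⟨(h2 a b hab).1, mem_of_mem_erase (h2 a b hab).2⟩
        · exact ⟨hab, hv⟩
      · intro a ha b hb haT hbT hab
        by_cases hav : a = v
        · exact Or.inl (Or.inr ⟨hav, hb, hav ▸ hab⟩)
        · by_cases hbv : b = v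
          · exact Or.inr (Or.inr ⟨hbv, ha, hbv ▸ hab.symm⟩)
          · exact (h3 a (mem_erase.2 ⟨hav, ha⟩) b (mem_erase.2 ⟨hbv, hb⟩) haT hbT hab).imp
              Or.inl Or.inl
      · intro a
        by_cases hav : a = v
        · subst hav
          refine le_trans ?_ hlt.le
          rw [← Set.ncard_coe_finset]
          refine Set.ncard_le_ncard ?_ (Finset.finite_toSet _)
          rintro b (hb | ⟨-, hb, hab⟩)
          · exact absurd (h2 a b hb).2 (notMem_erase a U)
          · simpa using ⟨hb, hab⟩
        · refine (Set.ncard_le_ncard ?_).trans (h4 a)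
          rintro b (hb | ⟨hb, -⟩)
          · exact hb
          · exact absurd hb hav

variable {E : Type*} [NormedAddCommGroup E] [InnerProductSpace ℝ E] {u : V → E}

/-- The diagonal contributes at most the sum of squares. Each edge term is charged to an oriented
sum once for each order of its ends, whence the factor 2. -/
theorem IsOrthRep.norm_sum_sq_le_of_orientation (hu : IsOrthRep G u) {K D : ℕ}
    (hK : LocallyColorable G K) (S : Finset V) (o : V → V → Prop)
    (hadj : ∀ a b, o a b → G.Adj a b)
    (ho : ∀ a ∈ S, ∀ b ∈ S, G.Adj a b → o a b ∨ o b a) (hD : ∀ a, {b | o a b}.ncard ≤ D)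
    (x : V → ℝ) :
    ‖∑ v ∈ S, x v • u v‖ ^ 2 ≤ (1 + 2 * √(K * D)) * ∑ a ∈ S, x a ^ 2 := by
  classical
  have hD' : ∀ a, #{b ∈ S | o a b} ≤ D := fun a => by
    refine le_trans ?_ (hD a)
    rw [← Set.ncard_coe_finset]
    exact Set.ncard_le_ncard fun b hb => (mem_filter.1 hb).2
  have h1 := hu.oriented_sum_le hK o hadj S S (fun a _ => hD' a) x
  rw [Real.mul_self_sqrt (sum_nonneg fun _ _ => sq_nonneg _)] at h1
  have h3 : ‖∑ v ∈ S, x v • u v‖ ^ 2 ≤ ∑ a ∈ S, x a ^ 2 +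
      ∑ a ∈ S, ∑ b ∈ S with o a b, |inner ℝ (u a) (u b) * x a * x b| +
      ∑ b ∈ S, ∑ a ∈ S with o b a, |inner ℝ (u b) (u a) * x b * x a| := by
    have hcomm : ∑ b ∈ S, ∑ a ∈ S with o b a, |inner ℝ (u b) (u a) * x b * x a| =
        ∑ a ∈ S, ∑ b ∈ S, if o b a then |inner ℝ (u b) (u a) * x b * x a| else 0 := by
      simp only [sum_filter]
      exact sum_comm
    nth_rw 2 [hcomm]
    rw [← real_inner_self_eq_norm_sq, sum_inner]
    simp only [sum_filter]
    rw [← sum_add_distrib, ← sum_add_distrib]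
    refine sum_le_sum fun a ha => ?_
    have hdiag : x a ^ 2 = ∑ b ∈ S, if a = b then x a ^ 2 else 0 := by simp [ha]
    rw [inner_sum, hdiag, ← sum_add_distrib, ← sum_add_distrib]
    refine sum_le_sum fun b hb => ?_
    have hsymm : |inner ℝ (u b) (u a) * x b * x a| = |inner ℝ (u a) (u b) * x a * x b| := by
      rw [real_inner_comm]; congr 1; ring
    have hin : inner ℝ (x a • u a) (x b • u b) = inner ℝ (u a) (u b) * x a * x b := by
      rw [inner_smul_left, inner_smul_right, conj_trivial]; ring
    rw [hsymm, hin]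
    set q := inner ℝ (u a) (u b) * x a * x b with hq
    have hq1 := le_abs_self q
    have hq2 := abs_nonneg q
    by_cases hab : G.Adj a b
    · rw [if_neg hab.ne]
      rcases ho a ha b hb hab with h | h
      · rw [if_pos h]; split_ifs <;> linarith
      · rw [if_pos h]; split_ifs <;> linarith
    · by_cases hne : a = b
      · rw [if_pos hne]
        have hle : q ≤ x a ^ 2 := by
          rw [hq, ← hne, real_inner_self_eq_norm_sq]
          have := pow_le_one₀ (n := 2) (norm_nonneg _) (hu.norm_le a)
          nlinarith [sq_nonneg (x a)]
        split_ifs <;> linarith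
      · rw [hq, hu.inner_eq_zero a b hne hab]
        simp [hne]
  linarith

theorem sum_card_neighbors_le (G : SimpleGraph V) [DecidableRel G.Adj] (T : Finset V) {D : ℕ}
    (hT : ∀ v ∈ T, D ≤ #{w ∈ T | G.Adj v w}) : #T * D ≤ 2 * G.edgeSet.ncard := by
  classical
  rw [← SimpleGraph.coe_edgeFinset, Set.ncard_coe_finset, ← G.sum_degrees_eq_twice_card_edges]
  calc #T * D = ∑ v ∈ T, D := by rw [sum_const, smul_eq_mul]
    _ ≤ ∑ v ∈ T, G.degree v := sum_le_sum fun v hv => (hT v hv).trans (card_le_card fun w hw => by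
        simpa using (mem_filter.1 hw).2)
    _ ≤ ∑ v, G.degree v := sum_le_sum_of_subset (subset_univ T)

omit [Fintype V] in
theorem card_mul_le_extremalNumber {W : Type*} {H : SimpleGraph W} (hfree : H.Free G)
    [DecidableRel G.Adj] (T : Finset V) {D : ℕ} (hT : ∀ v ∈ T, D ≤ #{w ∈ T | G.Adj v w}) :
    #T * D ≤ 2 * SimpleGraph.extremalNumber #T H := by
  classical
  set G' := G.induce (T : Set V) with hG'
  have hfree' : H.Free G' := fun hc =>
    hfree (hc.trans ⟨(SimpleGraph.Embedding.induce (T : Set V)).toCopy⟩)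
  have h1 := sum_card_neighbors_le G' univ (D := D) (fun v _ => by
    refine (hT v v.2).trans ?_
    rw [← card_map (Function.Embedding.subtype _)]
    refine card_le_card fun w hw => ?_
    rw [mem_filter] at hw
    rw [mem_map]
    exact ⟨⟨w, hw.1⟩, by simpa [hG'] using hw.2, rfl⟩)
  have h2 := SimpleGraph.card_edgeFinset_le_extremalNumber hfree'
  rw [← SimpleGraph.coe_edgeFinset, Set.ncard_coe_finset] at h1
  rw [card_univ] at h1
  have h3 : Fintype.card (T : Set V) = #T := by simp
  rw [h3] at h1 h2
  omega

/-- The parameters infeasible for the complement of a graph without cycles of length `r` are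
bounded in terms of the number of edges and a degree threshold. -/
theorem exists_eigenvalue_bound_of_cycle_free [Nonempty V] {r : ℕ} (hr : 3 ≤ r)
    (hfree : (SimpleGraph.cycleGraph r).Free G) {κ : ℝ} (h2 : 2 ≤ κ)
    (hκ : ¬ ThetaFeasible Gᶜ κ) (D : ℕ) :
    ∃ l : ℝ, 0 ≤ l ∧ κ ≤ 2 * (1 + 2 * √(r * D)) + 2 * l ∧
      l ^ r * D ≤ (6 * r ^ 2 : ℝ) ^ r * (2 * G.edgeSet.ncard) := by
  classical
  obtain ⟨m, u, y, hu, hy0, hy⟩ := exists_orthRep_of_not_thetaFeasible G h2 hκ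
  obtain ⟨T, o, h1, ho1, ho2, ho3⟩ := exists_core G D
  have hloc := locallyColorable_of_cycle_free hr hfree
  have hu' := hu.indicator T
  obtain ⟨x, l, hl, hx0, heig, hmax⟩ := exists_top_eigenvector fun v => if v ∈ T then u v else 0
  have hle : ∑ v ∈ Tᶜ, y v ^ 2 ≤ ∑ v, y v ^ 2 :=
    sum_le_sum_of_subset_of_nonneg (subset_univ _) fun _ _ _ => sq_nonneg _
  refine ⟨l, hl, ?_, ?_⟩
  · have hS := hu.norm_sum_sq_le_of_orientation hloc Tᶜ o ho1
      (fun a ha b hb => ho2 a b (mem_compl.1 ha) (mem_compl.1 hb)) ho3 y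
    have hTm := hmax y
    have e1 : ∑ v, y v • (if v ∈ T then u v else 0) = ∑ v ∈ T, y v • u v := by
      simp [smul_ite]
    rw [e1] at hTm
    rw [← sum_add_sum_compl T fun v => y v • u v] at hy
    -- The parallelogram law separates the core from the rest, at the cost of a factor 2 on each
    -- part.
    have hpar := parallelogram_law_with_norm ℝ (∑ v ∈ T, y v • u v) (∑ v ∈ Tᶜ, y v • u v)
    have hnn := sq_nonneg ‖∑ v ∈ T, y v • u v - ∑ v ∈ Tᶜ, y v • u v‖
    have hS' : ‖∑ v ∈ Tᶜ, y v • u v‖ ^ 2 ≤ (1 + 2 * √(r * D)) * ∑ v, y v ^ 2 :=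
      hS.trans (mul_le_mul_of_nonneg_left hle (by positivity))
    refine le_of_mul_le_mul_right ?_ hy0
    nlinarith
  -- Summing the entrywise bound costs only `#T`: an eigenvector for a nonzero eigenvalue vanishes
  -- off `T`, where the vectors are zero.
  · have hbound : l ^ r ≤ #T * (6 * r ^ 2 : ℝ) ^ r := by
      refine le_of_mul_le_mul_right ?_ hx0
      have hoff : ∀ v, v ∉ T → l ^ r * x v ^ 2 = 0 := by
        intro v hv
        have := heig v
        rw [if_neg hv, inner_zero_left] at this
        rcases mul_eq_zero.1 this.symm with h | h
        · rw [h, zero_pow (by omega), zero_mul]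
        · rw [h]; ring
      calc l ^ r * ∑ v, x v ^ 2 = ∑ v ∈ T, l ^ r * x v ^ 2 := by
            rw [mul_sum]
            exact (sum_subset (subset_univ T) fun v _ hv => hoff v hv).symm
        _ ≤ ∑ v ∈ T, (6 * r ^ 2 : ℝ) ^ r * ∑ w, x w ^ 2 :=
            sum_le_sum fun v _ => hu'.eigenvalue_pow_mul_sq_le hr hfree hl heig v
        _ = _ := by rw [sum_const, nsmul_eq_mul, mul_assoc]
    have hTD : (#T : ℝ) * D ≤ 2 * G.edgeSet.ncard := by
      exact_mod_cast sum_card_neighbors_le G T h1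
    calc l ^ r * D ≤ (#T * (6 * r ^ 2 : ℝ) ^ r) * D :=
          mul_le_mul_of_nonneg_right hbound (by positivity)
      _ = (6 * r ^ 2 : ℝ) ^ r * (#T * D) := by ring
      _ ≤ _ := mul_le_mul_of_nonneg_left hTD (by positivity)

/-- The value `b + 2` is at least 2 and exceeds `b`, so it is feasible for every competing graph. -/
theorem thetaMu_le {W : Type*} {H : SimpleGraph W} {m : ℕ} {b : ℝ} (hb : 0 ≤ b)
    (h : ∀ (n : ℕ) (G : SimpleGraph (Fin n)), H.Free G → G.edgeSet.ncard = m →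
      ∀ κ, 2 ≤ κ → ¬ ThetaFeasible Gᶜ κ → κ ≤ b) : thetaMu m H ≤ b + 2 := by
  refine Real.sSup_le ?_ (by linarith)
  rintro t ⟨n, G, hfree, hm, rfl⟩
  refine csInf_le ⟨2, fun κ hκ => hκ.1⟩ ?_
  by_contra hcon
  have := h n G hfree hm (b + 2) (by linarith) hcon
  linarith

theorem nonempty_of_edgeSet_ncard {V : Type*} {G : SimpleGraph V} (h : 1 ≤ G.edgeSet.ncard) :
    Nonempty V := by
  obtain ⟨e, -⟩ := Set.nonempty_of_ncard_ne_zero (s := G.edgeSet) (by omega)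
  exact ⟨e.out.1⟩

theorem thetaMu_cycleGraph_le {r m : ℕ} (hr : 3 ≤ r) (hm : 1 ≤ m) :
    thetaMu m (SimpleGraph.cycleGraph r) ≤
      (4 + 8 * r + 24 * r ^ 2) * (m : ℝ) ^ (1 / ((r : ℝ) + 2)) := by
  set M : ℝ := (m : ℝ) ^ (1 / ((r : ℝ) + 2)) with hM
  have hm1 : (1 : ℝ) ≤ m := by exact_mod_cast hm
  have hr3 : (3 : ℝ) ≤ r := by exact_mod_cast hr
  have hM1 : 1 ≤ M := Real.one_le_rpow hm1 (by positivity)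
  have hMpow : M ^ (r + 2) = m := by
    rw [hM, ← Real.rpow_natCast, ← Real.rpow_mul (by positivity)]
    push_cast
    rw [one_div_mul_cancel (by positivity), Real.rpow_one]
  -- With `M ^ (r + 2) = m` this threshold makes both `√D` and `(m / D) ^ (1 / r)` of order `M`.
  set D := ⌈M ^ 2⌉₊ with hD
  have hD1 : M ^ 2 ≤ D := Nat.le_ceil _
  have hD2 : (D : ℝ) ≤ 2 * M ^ 2 := by
    have := (Nat.ceil_lt_add_one (by positivity : 0 ≤ M ^ 2)).le
    nlinarith
  have hmain : thetaMu m (SimpleGraph.cycleGraph r) ≤ (2 + 8 * r * M + 24 * r ^ 2 * M) + 2 := by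
    refine thetaMu_le (by positivity) fun n G hfree hGm κ h2 hκ => ?_
    have hne := nonempty_of_edgeSet_ncard (G := G) (by omega)
    obtain ⟨l, hl, hκl, hlD⟩ := exists_eigenvalue_bound_of_cycle_free hr hfree h2 hκ D
    rw [hGm] at hlD
    have hlM : l ≤ 12 * r ^ 2 * M := by
      refine le_of_pow_le_pow_left₀ (n := r) (by omega) (by positivity) ?_
      have hMpos : 0 < M ^ 2 := by positivity
      refine le_of_mul_le_mul_right ?_ hMpos
      have h2r : (2 : ℝ) ≤ 2 ^ r := by
        calc (2 : ℝ) = 2 ^ 1 := by norm_num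
          _ ≤ 2 ^ r := pow_le_pow_right₀ (by norm_num) (by omega)
      calc l ^ r * M ^ 2 ≤ l ^ r * D := mul_le_mul_of_nonneg_left hD1 (by positivity)
        _ ≤ (6 * r ^ 2 : ℝ) ^ r * (2 * m) := hlD
        _ ≤ (6 * r ^ 2 : ℝ) ^ r * (2 ^ r * m) := by gcongr
        _ = (12 * r ^ 2 * M) ^ r * M ^ 2 := by
          rw [← hMpow, pow_add, ← mul_assoc, ← mul_assoc, ← mul_pow, ← mul_pow]
          ring
    have hsq : √((r : ℝ) * D) ≤ 2 * r * M := by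
      refine Real.sqrt_le_iff.2 ⟨by positivity, ?_⟩
      calc (r : ℝ) * D ≤ r * (2 * M ^ 2) := by gcongr
        _ ≤ (2 * r * M) ^ 2 := by nlinarith [mul_pos (by positivity : (0:ℝ) < r) (by positivity : 0 < M ^ 2)]
    linarith
  refine hmain.trans ?_
  nlinarith

end Core

/-! ### Forests in neighbourhoods and local colourability -/

section Forest

/-- This is the vertex peeled off when embedding a forest: a leaf of a nontrivial component, or else
an isolated vertex. -/
theorem SimpleGraph.IsAcyclic.exists_subsingleton_neighbors {W : Type*} [Finite W] [Nonempty W]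
    {F : SimpleGraph W} (hF : F.IsAcyclic) : ∃ v, ∀ a b, F.Adj v a → F.Adj v b → a = b := by
  classical
  have := Fintype.ofFinite W
  obtain ⟨v₀⟩ := ‹Nonempty W›
  set c := F.connectedComponentMk v₀
  have hT := hF.isTree_connectedComponent c
  by_cases hn : Nontrivial c
  · obtain ⟨v, hv⟩ := hT.exists_vert_degree_one_of_nontrivial
    refine ⟨v, fun a b ha hb => ?_⟩
    have hmem : ∀ a, F.Adj v a → a ∈ c := fun a h =>
      SimpleGraph.ConnectedComponent.mem_supp_of_adj_mem_supp c v.2 h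
    obtain ⟨z, hz⟩ := card_eq_one.1 hv
    have hza : ∀ a (h : F.Adj v a), (⟨a, hmem a h⟩ : c) = z := fun a h => by
      rw [← mem_singleton, ← hz, SimpleGraph.mem_neighborFinset]
      exact h
    have := (hza a ha).trans (hza b hb).symm
    exact congrArg Subtype.val this
  · refine ⟨v₀, fun a b ha _ => ?_⟩
    have hv₀ : v₀ ∈ c := rfl
    have hac : a ∈ c := SimpleGraph.ConnectedComponent.mem_supp_of_adj_mem_supp c hv₀ ha
    exact absurd ⟨⟨⟨v₀, hv₀⟩, ⟨a, hac⟩, fun h => ha.ne (congrArg Subtype.val h)⟩⟩ hn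

variable {V W : Type*} {G : SimpleGraph V} [DecidableRel G.Adj]

/-- A forest embeds into a nonempty set of vertices of large minimum degree. -/
theorem exists_forest_embedding [Fintype W] {F : SimpleGraph W} (hF : F.IsAcyclic) (S : Finset V)
    (hne : S.Nonempty) (hS : ∀ v ∈ S, Fintype.card W ≤ #{w ∈ S | G.Adj v w}) :
    ∃ g : W → V, (∀ a, g a ∈ S) ∧ Function.Injective g ∧ ∀ a b, F.Adj a b → G.Adj (g a) (g b) := by
  classical
  obtain ⟨s₀, hs₀⟩ := hne
  suffices h : ∀ A : Finset W, ∃ g : W → V, (∀ a ∈ A, g a ∈ S) ∧ Set.InjOn g A ∧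
      ∀ a ∈ A, ∀ b ∈ A, F.Adj a b → G.Adj (g a) (g b) by
    obtain ⟨g, h1, h2, h3⟩ := h univ
    exact ⟨g, fun a => h1 a (mem_univ a), fun a b hab => h2 (by simp) (by simp) hab,
      fun a b => h3 a (mem_univ a) b (mem_univ b)⟩
  intro A
  induction A using Finset.strongInduction with
  | H A ih =>
    rcases A.eq_empty_or_nonempty with rfl | hA
    · exact ⟨fun _ => s₀, by simp, by simp, by simp⟩
    have : Nonempty (A : Set W) := hA.to_subtype
    obtain ⟨⟨v, hv⟩, hleaf⟩ := (hF.induce (A : Set W)).exists_subsingleton_neighbors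
    replace hv : v ∈ A := hv
    replace hleaf : ∀ a ∈ A, ∀ b ∈ A, F.Adj v a → F.Adj v b → a = b := fun a ha b hb hva hvb =>
      congrArg Subtype.val (hleaf ⟨a, ha⟩ ⟨b, hb⟩ hva hvb)
    obtain ⟨g, h1, h2, h3⟩ := ih (A.erase v) (erase_ssubset hv)
    -- `s` is the image of the only neighbour of `v` in `A`, or arbitrary if there is none. It has
    -- more neighbours in `S` than there are vertices already placed.
    obtain ⟨s, hs, hsadj⟩ : ∃ s ∈ S, ∀ a ∈ A, F.Adj v a → s = g a := by
      by_cases hex : ∃ a ∈ A, F.Adj v a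
      · obtain ⟨a, ha, hva⟩ := hex
        exact ⟨g a, h1 a (mem_erase.2 ⟨hva.ne.symm, ha⟩), fun b hb hvb => by
          rw [hleaf a ha b hb hva hvb]⟩
      · exact ⟨s₀, hs₀, fun a ha hva => absurd ⟨a, ha, hva⟩ hex⟩
    obtain ⟨z, hz, hzn⟩ : ∃ z ∈ ({w ∈ S | G.Adj s w} : Finset V), z ∉ (A.erase v).image g := by
      refine exists_mem_notMem_of_card_lt_card ?_
      calc #((A.erase v).image g) ≤ #(A.erase v) := card_image_le
        _ < #A := card_erase_lt_of_mem hv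
        _ ≤ Fintype.card W := card_le_univ A
        _ ≤ _ := hS s hs
    rw [mem_filter] at hz
    have hgz : ∀ a ∈ A, a ≠ v → g a ≠ z := fun a ha hav he =>
      hzn (mem_image.2 ⟨a, mem_erase.2 ⟨hav, ha⟩, he⟩)
    refine ⟨Function.update g v z, fun a ha => ?_, fun a ha b hb hab => ?_, fun a ha b hb hab => ?_⟩
    · by_cases hav : a = v
      · rw [hav, Function.update_self]; exact hz.1
      · rw [Function.update_of_ne hav]; exact h1 a (mem_erase.2 ⟨hav, ha⟩)
    · by_cases hav : a = v
      · by_cases hbv : b = v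
        · rw [hav, hbv]
        · rw [hav, Function.update_self, Function.update_of_ne hbv] at hab
          exact absurd hab.symm (hgz b hb hbv)
      · by_cases hbv : b = v
        · rw [hbv, Function.update_self, Function.update_of_ne hav] at hab
          exact absurd hab (hgz a ha hav)
        · rw [Function.update_of_ne hav, Function.update_of_ne hbv] at hab
          exact h2 (mem_coe.2 (mem_erase.2 ⟨hav, ha⟩)) (mem_coe.2 (mem_erase.2 ⟨hbv, hb⟩)) hab
    · by_cases hav : a = v
      · subst hav
        rw [Function.update_self, Function.update_of_ne hab.ne.symm, ← hsadj b hb hab]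
        exact hz.2.symm
      · by_cases hbv : b = v
        · subst hbv
          rw [Function.update_self, Function.update_of_ne hab.ne, ← hsadj a ha hab.symm]
          exact hz.2
        · rw [Function.update_of_ne hav, Function.update_of_ne hbv]
          exact h3 a (mem_erase.2 ⟨hav, ha⟩) b (mem_erase.2 ⟨hbv, hb⟩) hab

/-- Greedy colouring of a degenerate vertex set. -/
theorem exists_coloring_of_degenerate {D : ℕ} (hD : 0 < D) (U : Finset V)
    (hU : ∀ S ⊆ U, S.Nonempty → ∃ s ∈ S, #{w ∈ S | G.Adj s w} < D) :
    ∃ f : V → Fin D, ∀ a ∈ U, ∀ b ∈ U, G.Adj a b → f a ≠ f b := by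
  classical
  induction U using Finset.strongInduction with
  | H U ih =>
    rcases U.eq_empty_or_nonempty with rfl | hne
    · exact ⟨fun _ => ⟨0, hD⟩, by simp⟩
    obtain ⟨s, hs, hlt⟩ := hU U subset_rfl hne
    obtain ⟨f, hf⟩ := ih (U.erase s) (erase_ssubset hs) fun S hS =>
      hU S (hS.trans (erase_subset _ _))
    obtain ⟨j, -, hj⟩ : ∃ j ∈ (univ : Finset (Fin D)), j ∉ ({w ∈ U | G.Adj s w} : Finset V).image f := by
      refine exists_mem_notMem_of_card_lt_card (card_image_le.trans_lt ?_)
      rwa [card_univ, Fintype.card_fin]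
    have hj' : ∀ b ∈ U, G.Adj s b → f b ≠ j := fun b hb hsb he =>
      hj (mem_image.2 ⟨b, mem_filter.2 ⟨hb, hsb⟩, he⟩)
    refine ⟨Function.update f s j, fun a ha b hb hab => ?_⟩
    by_cases has : a = s
    · subst has
      rw [Function.update_self, Function.update_of_ne hab.ne.symm]
      exact (hj' b hb hab).symm
    · by_cases hbs : b = s
      · subst hbs
        rw [Function.update_self, Function.update_of_ne hab.ne]
        exact hj' a ha hab.symm
      · rw [Function.update_of_ne has, Function.update_of_ne hbs]
        exact hf a (mem_erase.2 ⟨has, ha⟩) b (mem_erase.2 ⟨hbs, hb⟩) hab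

omit [DecidableRel G.Adj] in
/-- If removing a vertex makes `H` acyclic, then neighbourhoods in `H`-free graphs have bounded
chromatic number. -/
theorem locallyColorable_of_free [Fintype V] [Fintype W] {H : SimpleGraph W}
    (hH : HasVertexWithAcyclicRemoval H) (hfree : H.Free G) :
    LocallyColorable G (Fintype.card W) := by
  classical
  obtain ⟨v₀, hF⟩ := hH
  intro v
  -- A nonempty part of the neighbourhood of `v` with minimum degree at least `|W|` would contain
  -- the forest `H - v₀`, and `v` in the role of `v₀` would complete a copy of `H`.
  obtain ⟨f, hf⟩ := exists_coloring_of_degenerate (G := G) (Fintype.card_pos_iff.2 ⟨v₀⟩)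
    ({w | G.Adj v w} : Finset V) (fun S hSv hne => by
      by_contra hcon
      push Not at hcon
      obtain ⟨g, hgS, hginj, hgadj⟩ := exists_forest_embedding hF S hne (fun s hs =>
        (Fintype.card_subtype_le _).trans (hcon s hs))
      have hgv : ∀ a, G.Adj v (g a) := fun a => by simpa using hSv (hgS a)
      let φ : W → V := fun a => if h : a = v₀ then v else g ⟨a, h⟩
      have φ0 : φ v₀ = v := by simp [φ]
      have φ1 : ∀ a (h : a ≠ v₀), φ a = g ⟨a, h⟩ := fun a h => by simp [φ, h]
      refine hfree ⟨⟨⟨φ, fun {a b} hab => ?_⟩, fun a b hab => ?_⟩⟩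
      · by_cases ha : a = v₀
        · subst ha
          rw [φ0, φ1 b hab.ne.symm]
          exact hgv _
        · by_cases hb : b = v₀
          · subst hb
            rw [φ0, φ1 a ha]
            exact (hgv _).symm
          · rw [φ1 a ha, φ1 b hb]
            exact hgadj _ _ hab
      · change φ a = φ b at hab
        by_cases ha : a = v₀
        · by_cases hb : b = v₀
          · rw [ha, hb]
          · rw [ha, φ0, φ1 b hb] at hab
            exact absurd hab (hgv _).ne
        · by_cases hb : b = v₀
          · rw [hb, φ0, φ1 a ha] at hab
            exact absurd hab.symm (hgv _).ne
          · rw [φ1 a ha, φ1 b hb] at hab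
            exact congrArg Subtype.val (hginj hab))
  exact ⟨f, fun a b ha hb => hf a (by simpa using ha) b (by simpa using hb)⟩

end Forest

/-! ### Bounds from the extremal number -/

section Turan

/-- The ratios at the finitely many exceptional `n` are added to the constant. -/
theorem exists_mul_bound_of_eventually (f g : ℕ → ℝ) (hg : ∀ n, 1 ≤ n → 0 < g n) (C : ℝ)
    (h : ∀ᶠ n in Filter.atTop, f n ≤ C * g n) : ∃ C', 0 ≤ C' ∧ ∀ n, 1 ≤ n → f n ≤ C' * g n := by
  obtain ⟨N, hN⟩ := Filter.eventually_atTop.1 h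
  refine ⟨|C| + ∑ n ∈ range N, |f n| / |g n|, by positivity, fun n hn => ?_⟩
  have hgn := hg n hn
  have hsum : 0 ≤ ∑ n ∈ range N, |f n| / |g n| := by positivity
  rcases le_or_gt N n with hNn | hnN
  · exact (hN n hNn).trans (mul_le_mul_of_nonneg_right (by linarith [le_abs_self C]) hgn.le)
  · have h1 : |f n| / |g n| ≤ ∑ n ∈ range N, |f n| / |g n| :=
      single_le_sum (f := fun n => |f n| / |g n|) (fun _ _ => by positivity) (mem_range.2 hnN)
    calc f n ≤ |f n| := le_abs_self _
      _ = |f n| / |g n| * g n := by rw [abs_of_pos hgn]; field_simp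
      _ ≤ _ := mul_le_mul_of_nonneg_right (by linarith [abs_nonneg C]) hgn.le

theorem exists_extremalNumber_bound {W : Type*} {H : SimpleGraph W} {α : ℝ}
    (hex : (fun n : ℕ => (SimpleGraph.extremalNumber n H : ℝ)) =O[Filter.atTop]
      fun n : ℕ => (n : ℝ) ^ (1 + α)) :
    ∃ C : ℝ, 0 ≤ C ∧ ∀ n : ℕ, 1 ≤ n → (SimpleGraph.extremalNumber n H : ℝ) ≤ C * (n : ℝ) ^ (1 + α) := by
  obtain ⟨C, hC⟩ := hex.bound
  refine exists_mul_bound_of_eventually _ _ (fun n hn => ?_) C (hC.mono fun n hn => ?_)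
  · have : (0 : ℝ) < n := by exact_mod_cast hn
    positivity
  · rwa [Real.norm_of_nonneg (by positivity), Real.norm_of_nonneg (by positivity)] at hn

variable {V W : Type*} [Fintype V] {G : SimpleGraph V} {H : SimpleGraph W}

/-- A graph with an orientation of bounded out-degree and locally bounded chromatic number has
bounded Lovász theta function of the complement. -/
theorem le_of_not_thetaFeasible_of_core_eq_empty [Nonempty V] {K D : ℕ}
    (hK : LocallyColorable G K) [DecidableRel G.Adj]
    (hD : ∀ T : Finset V, (∀ v ∈ T, D ≤ #{w ∈ T | G.Adj v w}) → T = ∅) {κ : ℝ} (h2 : 2 ≤ κ)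
    (hκ : ¬ ThetaFeasible Gᶜ κ) : κ ≤ 1 + 2 * √(K * D) := by
  obtain ⟨m, u, y, hu, hy0, hy⟩ := exists_orthRep_of_not_thetaFeasible G h2 hκ
  obtain ⟨T, o, h1, ho1, ho2, ho3⟩ := exists_core G D
  have hT := hD T h1
  have h := hu.norm_sum_sq_le_of_orientation hK univ o ho1
    (fun a _ b _ => ho2 a b (by simp [hT]) (by simp [hT])) ho3 y
  exact le_of_mul_le_mul_right (hy.trans h) hy0

/-- A vertex set of minimum degree at least `D` in an `H`-free graph with `m` edges forces `D` to
be small. -/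
theorem rpow_le_of_core_nonempty {α C : ℝ} (hα : 0 ≤ α) (hC : 0 ≤ C)
    (hex : ∀ n : ℕ, 1 ≤ n → (SimpleGraph.extremalNumber n H : ℝ) ≤ C * (n : ℝ) ^ (1 + α))
    (hfree : H.Free G) [DecidableRel G.Adj] (T : Finset V) (hne : T.Nonempty) {D : ℕ}
    (hT : ∀ v ∈ T, D ≤ #{w ∈ T | G.Adj v w}) :
    (D : ℝ) ^ (1 + α) ≤ 2 * C * (2 * G.edgeSet.ncard : ℝ) ^ α := by
  rcases Nat.eq_zero_or_pos D with rfl | hDpos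
  · rw [Nat.cast_zero, Real.zero_rpow (by linarith)]
    positivity
  have hDpos' : (0 : ℝ) < D := by exact_mod_cast hDpos
  have hcard : 1 ≤ #T := hne.card_pos
  have ht : (0 : ℝ) < #T := by exact_mod_cast hcard
  have h1 : (#T : ℝ) * D ≤ 2 * G.edgeSet.ncard := by
    exact_mod_cast sum_card_neighbors_le G T hT
  have h2 : (#T : ℝ) * D ≤ 2 * SimpleGraph.extremalNumber #T H := by
    exact_mod_cast card_mul_le_extremalNumber hfree T hT
  have h3 : (#T : ℝ) * D ≤ #T * (2 * C * (#T : ℝ) ^ α) := by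
    refine h2.trans ?_
    have := hex _ hcard
    rw [Real.rpow_add ht, Real.rpow_one] at this
    linarith
  have h4 : (D : ℝ) ≤ 2 * C * (#T : ℝ) ^ α := le_of_mul_le_mul_left h3 ht
  -- Multiplying by `D ^ α` turns the unknown `#T ^ α` into `(#T * D) ^ α`, which the edge count
  -- bounds.
  calc (D : ℝ) ^ (1 + α) = D * (D : ℝ) ^ α := by rw [Real.rpow_add hDpos', Real.rpow_one]
    _ ≤ (2 * C * (#T : ℝ) ^ α) * (D : ℝ) ^ α :=
        mul_le_mul_of_nonneg_right h4 (by positivity)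
    _ = 2 * C * ((#T : ℝ) * D) ^ α := by rw [Real.mul_rpow ht.le hDpos'.le]; ring
    _ ≤ _ := mul_le_mul_of_nonneg_left (Real.rpow_le_rpow (by positivity) h1 hα) (by positivity)

theorem exists_thetaMu_bound_of_nonneg [Fintype W] (hH : HasVertexWithAcyclicRemoval H) {α : ℝ}
    (hα : 0 ≤ α) (hex : (fun n : ℕ => (SimpleGraph.extremalNumber n H : ℝ)) =O[Filter.atTop]
      fun n : ℕ => (n : ℝ) ^ (1 + α)) :
    ∃ C : ℝ, ∀ m : ℕ, 1 ≤ m → thetaMu m H ≤ C * (m : ℝ) ^ (α / (2 * α + 2)) := by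
  classical
  obtain ⟨C, hC0, hC⟩ := exists_extremalNumber_bound hex
  set K := Fintype.card W
  -- `Q ^ (1 + α) ≥ Q > 2 * C * 2 ^ α`, so any `D > Q * M ^ 2` violates `rpow_le_of_core_nonempty`
  -- and the core is empty.
  set Q : ℝ := 1 + 2 * C * 2 ^ α with hQ
  have h2α : (0 : ℝ) < 2 ^ α := by positivity
  have hQ1 : 1 ≤ Q := by rw [hQ]; linarith [mul_nonneg hC0 h2α.le]
  refine ⟨3 + 2 * √(2 * K * Q), fun m hm => ?_⟩
  have hm1 : (1 : ℝ) ≤ m := by exact_mod_cast hm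
  set M : ℝ := (m : ℝ) ^ (α / (2 * α + 2)) with hM
  have hM1 : 1 ≤ M := Real.one_le_rpow hm1 (by positivity)
  have hMpow : (M ^ 2) ^ (1 + α) = (m : ℝ) ^ α := by
    rw [hM, ← Real.rpow_natCast, ← Real.rpow_mul (by positivity), ← Real.rpow_mul (by positivity)]
    congr 1
    push_cast
    field_simp
    ring
  set D := ⌊Q * M ^ 2⌋₊ + 1 with hD
  have hQM : 1 ≤ Q * M ^ 2 := one_le_mul_of_one_le_of_one_le hQ1 (one_le_pow₀ hM1)
  have hD1 : Q * M ^ 2 < D := by rw [hD]; exact_mod_cast Nat.lt_floor_add_one _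
  have hD2 : (D : ℝ) ≤ 2 * (Q * M ^ 2) := by
    have := Nat.floor_le (by linarith : 0 ≤ Q * M ^ 2)
    rw [hD]; push_cast; linarith
  have hmain : thetaMu m H ≤ (1 + 2 * (√(2 * K * Q) * M)) + 2 := by
    refine thetaMu_le (by positivity) fun n G hfree hGm κ h2 hκ => ?_
    have hne := nonempty_of_edgeSet_ncard (G := G) (by omega)
    have hκD := le_of_not_thetaFeasible_of_core_eq_empty (D := D)
      (locallyColorable_of_free hH hfree) (fun T hT => by
        by_contra hTne
        have h := rpow_le_of_core_nonempty hα hC0 hC hfree T (nonempty_iff_ne_empty.2 hTne) hT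
        rw [hGm] at h
        have h' : (Q * M ^ 2) ^ (1 + α) < (D : ℝ) ^ (1 + α) :=
          Real.rpow_lt_rpow (by linarith) hD1 (by linarith)
        rw [Real.mul_rpow (by linarith) (by positivity), hMpow] at h'
        rw [Real.mul_rpow (by norm_num) (by linarith)] at h
        have hQQ : Q ≤ Q ^ (1 + α) := by
          conv_lhs => rw [← Real.rpow_one Q]
          exact Real.rpow_le_rpow_of_exponent_le hQ1 (by linarith)
        have hmα : (0 : ℝ) < (m : ℝ) ^ α := by positivity
        have h5 := mul_le_mul_of_nonneg_right hQQ hmα.le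
        have h6 : 2 * C * (2 ^ α * (m : ℝ) ^ α) < Q * (m : ℝ) ^ α := by
          rw [hQ]; linarith
        linarith) h2 hκ
    refine hκD.trans ?_
    have : √((K : ℝ) * D) ≤ √(2 * K * Q) * M := by
      refine Real.sqrt_le_iff.2 ⟨by positivity, ?_⟩
      rw [mul_pow, Real.sq_sqrt (by positivity)]
      calc (K : ℝ) * D ≤ K * (2 * (Q * M ^ 2)) := mul_le_mul_of_nonneg_left hD2 (by positivity)
        _ = _ := by ring
    linarith
  refine hmain.trans ?_
  nlinarith

/-- With a sublinear extremal number, an `H`-free graph has boundedly many edges. -/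
theorem exists_edge_bound_of_neg {α : ℝ} (hα : α < 0)
    (hex : (fun n : ℕ => (SimpleGraph.extremalNumber n H : ℝ)) =O[Filter.atTop]
      fun n : ℕ => (n : ℝ) ^ (1 + α)) :
    ∃ m₀ : ℕ, ∀ (n : ℕ) (G : SimpleGraph (Fin n)), H.Free G → G.edgeSet.ncard ≤ m₀ := by
  classical
  obtain ⟨C, hC0, hC⟩ := exists_extremalNumber_bound hex
  have htend : Filter.Tendsto (fun t : ℕ => (t : ℝ) ^ (-α)) Filter.atTop Filter.atTop :=
    (tendsto_rpow_atTop (by linarith)).comp tendsto_natCast_atTop_atTop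
  obtain ⟨t₀, ht₀⟩ := Filter.eventually_atTop.1 (htend.eventually_gt_atTop (2 * C))
  refine ⟨t₀ * t₀, fun n G hfree => ?_⟩
  -- On the non-isolated vertices every degree is at least 1, so `#T ≤ 2 * ex(#T, H) = O(#T ^ (1 +
  -- α))`, which bounds `#T` because `α < 0`.
  set T : Finset (Fin n) := {v | ∃ w, G.Adj v w} with hT
  have hmemT : ∀ v w, G.Adj v w → v ∈ T := fun v w h => by
    rw [hT, mem_filter]; exact ⟨mem_univ _, w, h⟩
  have hdeg : ∀ v ∈ T, 1 ≤ #{w ∈ T | G.Adj v w} := by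
    intro v hv
    obtain ⟨-, w, hw⟩ := mem_filter.1 hv
    exact card_pos.2 ⟨w, mem_filter.2 ⟨hmemT w v hw.symm, hw⟩⟩
  have hcard : #T ≤ t₀ := by
    by_contra hlt
    push Not at hlt
    have hpos : 1 ≤ #T := by omega
    have hpos' : (0 : ℝ) < #T := by exact_mod_cast hpos
    have h1 : (#T : ℝ) ≤ 2 * SimpleGraph.extremalNumber #T H := by
      exact_mod_cast (by simpa using card_mul_le_extremalNumber hfree T hdeg)
    have h2 := hC _ hpos
    rw [Real.rpow_add hpos', Real.rpow_one] at h2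
    have h3 := ht₀ #T hlt.le
    have h4 : (#T : ℝ) * 1 ≤ #T * (2 * C * (#T : ℝ) ^ α) := by linarith
    have h5 := le_of_mul_le_mul_left h4 hpos'
    have h6 : (0 : ℝ) < (#T : ℝ) ^ α := by positivity
    have h7 : (#T : ℝ) ^ (-α) * (#T : ℝ) ^ α = 1 := by
      rw [← Real.rpow_add hpos']; simp
    nlinarith
  have hsum := G.sum_degrees_eq_twice_card_edges
  have hle : ∑ v, G.degree v ≤ #T * #T := by
    calc ∑ v, G.degree v = ∑ v ∈ T, G.degree v := by
          refine (sum_subset (subset_univ T) fun v _ hv => ?_).symm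
          rw [← SimpleGraph.card_neighborFinset_eq_degree, card_eq_zero]
          refine eq_empty_of_forall_notMem fun w hw => hv (hmemT v w ?_)
          simpa using hw
      _ ≤ ∑ v ∈ T, #T := sum_le_sum fun v _ => by
          rw [← SimpleGraph.card_neighborFinset_eq_degree]
          refine card_le_card fun w hw => hmemT w v ?_
          simpa using ((SimpleGraph.mem_neighborFinset _ _ _).1 hw).symm
      _ = #T * #T := by rw [sum_const, smul_eq_mul]
  rw [← SimpleGraph.coe_edgeFinset, Set.ncard_coe_finset]
  have := Nat.mul_le_mul hcard hcard
  omega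

/-- For large `m` no `H`-free graph has `m` edges and `thetaMu` takes its default value 0; the
constant covers the remaining `m`. -/
theorem exists_thetaMu_bound_of_neg {α : ℝ} (hα : α < 0)
    (hex : (fun n : ℕ => (SimpleGraph.extremalNumber n H : ℝ)) =O[Filter.atTop]
      fun n : ℕ => (n : ℝ) ^ (1 + α)) :
    ∃ C : ℝ, ∀ m : ℕ, 1 ≤ m → thetaMu m H ≤ C * (m : ℝ) ^ (α / (2 * α + 2)) := by
  obtain ⟨m₀, hm₀⟩ := exists_edge_bound_of_neg hα hex
  obtain ⟨C, -, hC⟩ := exists_mul_bound_of_eventually (fun m => thetaMu m H)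
    (fun m => (m : ℝ) ^ (α / (2 * α + 2)))
    (fun m hm => by have : (0 : ℝ) < m := by exact_mod_cast hm
                    positivity) 0 (by
      filter_upwards [Filter.eventually_gt_atTop m₀] with m hm
      have hempty : complThetaValues m H = ∅ := by
        refine Set.eq_empty_of_forall_notMem ?_
        rintro t ⟨n, G, hfree, hGm, -⟩
        have := hm₀ n G hfree
        omega
      rw [thetaMu, hempty, Real.sSup_empty, zero_mul])
  exact ⟨C, hC⟩

end Turan

theorem corollary10 :
    (∀ r : ℕ, 3 ≤ r → ∃ C : ℝ, ∀ m : ℕ, 1 ≤ m →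
      thetaMu m (SimpleGraph.cycleGraph r) ≤ C * (m : ℝ) ^ (1 / ((r : ℝ) + 2))) ∧
    (∀ {W : Type*} [Fintype W] (H : SimpleGraph W), HasVertexWithAcyclicRemoval H →
      ∀ α : ℝ, α ≠ -1 →
        ((fun n : ℕ => (SimpleGraph.extremalNumber n H : ℝ)) =O[Filter.atTop]
          fun n : ℕ => (n : ℝ) ^ (1 + α)) →
        ∃ C : ℝ, ∀ m : ℕ, 1 ≤ m →
          thetaMu m H ≤ C * (m : ℝ) ^ (α / (2 * α + 2))) := by
  refine ⟨fun r hr => ⟨_, fun m hm => thetaMu_cycleGraph_le hr hm⟩, fun H hH α _ hex => ?_⟩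
  rcases lt_or_ge α 0 with hα | hα
  · exact exists_thetaMu_bound_of_neg hα hex
  · exact exists_thetaMu_bound_of_nonneg hH hα hex
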